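/- Let $d\in\{1,2,3\}$, $p\in[1,\infty)$, $\alpha\ge 0$, $\beta\in(0,1]$ and $\lambda\ge e^{(3+2\alpha)/\beta}$. Let $\mathcal L=\frac{|D|^\beta}{\log^\alpha(\lambda+|D|)}$ be the Fourier multiplier on $\mathbb R^d$ with symbol $\frac{|\xi|^\beta}{\log^\alpha(\lambda+|\xi|)}$. For $t>0$ let $K_t$ be the inverse Fourier transform of $\xi\mapsto \exp\big(-t\,\frac{|\xi|^\beta}{\log^\alpha(\lambda+|\xi|)}\big)$, and put $e^{-t\mathcal L}f=K_t\star f$ for $t>0$, $e^{-0\mathcal L}f=f$. All function spaces $L^p=L^p(\mathbb R^d)$ consist of complex-valued functions, and $f\ge 0$ means that $f$ is real and nonnegative a.e. Then $K_t\in L^1(\mathbb R^d)$ with $\widehat{K_t}(\xi)=\exp\big(-t\,\frac{|\xi|^\beta}{\log^\alpha(\lambda+|\xi|)}\big)$ for all $t>0$, and the following hold. 1. $(e^{-t\mathcal L})_{t\ge0}$ is a $C_0$-semigroup of contractions on $L^p$: each $e^{-t\mathcal L}$ is a bounded linear operator on $L^p$ of norm at most $1$ (with $K_t\star f$ given by an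 absolutely convergent integral a.e.), $e^{-0\mathcal L}=\mathrm{Id}$, $e^{-(t+s)\mathcal L}=e^{-t\mathcal L}e^{-s\mathcal L}$ for $s,t\ge0$, and $\lim_{t\to0^+}\|e^{-t\mathcal L}f-f\|_{L^p}=0$ for every $f\in L^p$. 2. This semigroup is sub-Markovian on $L^p$: for every $t\ge0$ and $f\in L^p$, if $f\ge0$ a.e. then $e^{-t\mathcal L}f\ge0$ a.e., and if $|f|\le1$ a.e. then $|e^{-t\mathcal L}f|\le1$ a.e. 3. On $L^2$ the situation of the Beurling–Deny theorem holds. The operator $\mathcal L$, with domain $\{f\in L^2:\mathcal L f\in L^2\}$ defined on the Fourier side, is nonnegative and self-adjoint; its nonnegative self-adjoint square root $\mathcal L^{1/2}$ is the Fourier multiplier with symbol $\big(\frac{|\xi|^\beta}{\log^\alpha(\lambda+|\xi|)}\big)^{1/2}$ on its maximal domain; the convolution family $(e^{-t\mathcal L})_{t\ge0}$ on $L^2$ is a $C_0$-semigroup of contractions with infinitesimal generator $-\mathcal L$; and both equivalent Beurling–Deny conditions are satisfied: (i) for all $t>0$, if $f\in L^2$ and $f\ge0$ a.e., then $e^{-t\mathcal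 L}f\ge0$ a.e.; (ii) if $f\in\mathcal D(\mathcal L^{1/2})$, then $|f|\in\mathcal D(\mathcal L^{1/2})$ and $\|\mathcal L^{1/2}|f|\|_{L^2}\le\|\mathcal L^{1/2}f\|_{L^2}$. -/

import Mathlib

open MeasureTheory Filter Topology

open scoped NNReal ENNReal FourierTransform Convolution ComplexOrder

noncomputable section

namespace LogDissipation

/-! ### Semigroups -/

/-- A `C₀`-semigroup of contractions on a normed space. -/
structure IsC0ContractionSemigroup {X : Type*} [NormedAddCommGroup X] [NormedSpace ℂ X]
    (T : ℝ≥0 → X →L[ℂ] X) : Prop where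
  map_zero : T 0 = ContinuousLinearMap.id ℂ X
  map_add : ∀ s t : ℝ≥0, T (s + t) = (T s).comp (T t)
  strongly_continuous : ∀ f : X, Tendsto (fun t : ℝ≥0 => ‖T t f - f‖) (𝓝[>] 0) (𝓝 0)
  norm_le_one : ∀ t : ℝ≥0, ‖T t‖ ≤ 1

/-- `A` is the infinitesimal generator of `T`: `f` lies in the domain of `A` and `A f = g` exactly
when `(T t f - f) / t` converges to `g` in `X` as `t → 0+`. -/
def IsGenerator {X : Type*} [NormedAddCommGroup X] [NormedSpace ℂ X]
    (A : X →ₗ.[ℂ] X) (T : ℝ≥0 → X →L[ℂ] X) : Prop :=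
  ∀ f g : X, (f, g) ∈ A.graph ↔
    Tendsto (fun t : ℝ≥0 => (((t : ℝ)⁻¹ : ℝ) : ℂ) • (T t f - f)) (𝓝[>] 0) (𝓝 g)

/-- The space `L^p(ℝ^d)` of complex-valued functions. -/
abbrev LpSpace (d : ℕ) (p : ℝ≥0∞) : Type := Lp ℂ p (volume : Measure (EuclideanSpace ℝ (Fin d)))

/-- A sub-Markovian semigroup on `L^p(ℝ^d)`. For a complex number `z`, the relation `0 ≤ z` means
that `z` is real and nonnegative. -/
structure IsSubMarkovian {d : ℕ} {p : ℝ≥0∞} [Fact (1 ≤ p)]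
    (T : ℝ≥0 → LpSpace d p →L[ℂ] LpSpace d p) : Prop
    extends IsC0ContractionSemigroup T where
  nonneg : ∀ f : LpSpace d p, (∀ᵐ x, 0 ≤ f x) → ∀ t, ∀ᵐ x, 0 ≤ T t f x
  norm_le : ∀ f : LpSpace d p, (∀ᵐ x, ‖f x‖ ≤ 1) → ∀ t, ∀ᵐ x, ‖T t f x‖ ≤ 1

/-! ### Nonnegative self-adjoint operators and the Beurling-Deny conditions -/

/-- A (possibly unbounded) nonnegative self-adjoint operator on a Hilbert space. -/
def IsNonnegSelfAdjoint {H : Type*} [NormedAddCommGroup H] [InnerProductSpace ℂ H]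
    [CompleteSpace H] (A : H →ₗ.[ℂ] H) : Prop :=
  IsSelfAdjoint A ∧ ∀ f : A.domain, 0 ≤ inner ℂ (f : H) (A f)

/-- `B` is the nonnegative self-adjoint square root of `A`: it is nonnegative and self-adjoint and
`B ∘ B = A`, with equality of the domains. -/
def IsNonnegSqrt {H : Type*} [NormedAddCommGroup H] [InnerProductSpace ℂ H]
    [CompleteSpace H] (B A : H →ₗ.[ℂ] H) : Prop :=
  IsNonnegSelfAdjoint B ∧
    ∀ f g : H, (f, g) ∈ A.graph ↔ ∃ h : H, (f, h) ∈ B.graph ∧ (h, g) ∈ B.graph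

/-- The space `L²(ℝ^d)`. -/
abbrev L2 (d : ℕ) : Type := LpSpace d 2

/-- The element `|f|` of `L²(ℝ^d)`. -/
def absL2 {d : ℕ} (f : L2 d) : L2 d :=
  MemLp.toLp (fun x => ((‖f x‖ : ℝ) : ℂ)) (Lp.memLp f).norm.ofReal

/-- The operator `A` is nonnegative and self-adjoint on `L²(ℝ^d)` with square root `A^{1/2} = B`,
the family `T` is the semigroup `e^{-tA}` (the `C₀`-semigroup of contractions that is generated
by `-A`), and both of the equivalent conditions of the Beurling-Deny theorem hold. -/
structure SatisfiesBeurlingDeny {d : ℕ} (A B : L2 d →ₗ.[ℂ] L2 d) (T : ℝ≥0 → L2 d →L[ℂ] L2 d) :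
    Prop where
  nonneg_selfAdjoint : IsNonnegSelfAdjoint A
  sqrt : IsNonnegSqrt B A
  semigroup : IsC0ContractionSemigroup T
  generator : IsGenerator (-A) T
  positivity : ∀ t, 0 < t → ∀ f : L2 d, (∀ᵐ x, 0 ≤ f x) → ∀ᵐ x, 0 ≤ T t f x
  abs_form : ∀ f : B.domain, ∃ h : absL2 (f : L2 d) ∈ B.domain, ‖B ⟨absL2 (f : L2 d), h⟩‖ ≤ ‖B f‖

/-! ### Fourier multipliers on `L²` -/

/-- The maximal domain of the Fourier multiplier with real symbol `m`: the functions `f ∈ L²` with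
`m · 𝓕 f ∈ L²`. -/
def multiplierDomain {d : ℕ} (m : EuclideanSpace ℝ (Fin d) → ℝ) : Submodule ℂ (L2 d) where
  carrier := {f | MemLp (fun η => (m η : ℂ) * (𝓕 f : L2 d) η) 2 volume}
  zero_mem' := by
    have h : (fun η => (m η : ℂ) * (𝓕 (0 : L2 d) : L2 d) η) =ᵐ[volume] 0 := by
      rw [FourierTransform.fourier_zero]
      filter_upwards [Lp.coeFn_zero ℂ 2 (volume : Measure (EuclideanSpace ℝ (Fin d)))] with η hη
      simp only [hη, Pi.zero_apply, mul_zero]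
    exact (memLp_congr_ae h).2 MemLp.zero
  add_mem' := by
    intro f g hf hg
    refine (memLp_congr_ae ?_).2 (MemLp.add hf hg)
    rw [FourierTransform.fourier_add]
    filter_upwards [Lp.coeFn_add (𝓕 f : L2 d) (𝓕 g : L2 d)] with η hη
    simp only [hη, Pi.add_apply, mul_add]
  smul_mem' := by
    intro c f hf
    refine (memLp_congr_ae ?_).2 (MemLp.const_smul hf c)
    rw [FourierTransform.fourier_smul]
    filter_upwards [Lp.coeFn_smul c (𝓕 f : L2 d)] with η hη
    simp only [hη, Pi.smul_apply, smul_eq_mul, mul_left_comm]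

/-- The product `m · 𝓕 f`, as an element of `L²(ℝ^d)`. -/
def mulFourier {d : ℕ} (m : EuclideanSpace ℝ (Fin d) → ℝ) (f : multiplierDomain m) : L2 d :=
  MemLp.toLp (fun η => (m η : ℂ) * (𝓕 (f : L2 d) : L2 d) η) f.2

theorem coeFn_mulFourier {d : ℕ} (m : EuclideanSpace ℝ (Fin d) → ℝ) (f : multiplierDomain m) :
    ∀ᵐ η, mulFourier m f η = (m η : ℂ) * (𝓕 (f : L2 d) : L2 d) η :=
  MemLp.coeFn_toLp _

theorem mulFourier_add {d : ℕ} (m : EuclideanSpace ℝ (Fin d) → ℝ) (f g : multiplierDomain m) :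
    mulFourier m (f + g) = mulFourier m f + mulFourier m g := by
  apply Lp.ext
  have h : (𝓕 ((f + g : multiplierDomain m) : L2 d) : L2 d) =
      (𝓕 (f : L2 d) : L2 d) + (𝓕 (g : L2 d) : L2 d) :=
    FourierTransform.fourier_add (f : L2 d) (g : L2 d)
  have h₁ := coeFn_mulFourier m (f + g)
  rw [h] at h₁
  filter_upwards [h₁, coeFn_mulFourier m f, coeFn_mulFourier m g,
    Lp.coeFn_add (mulFourier m f) (mulFourier m g),
    Lp.coeFn_add (𝓕 (f : L2 d) : L2 d) (𝓕 (g : L2 d) : L2 d)] with η e₁ e₂ e₃ e₄ e₅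
  rw [e₁, e₄, e₅, Pi.add_apply, Pi.add_apply, e₂, e₃, mul_add]

theorem mulFourier_smul {d : ℕ} (m : EuclideanSpace ℝ (Fin d) → ℝ) (c : ℂ)
    (f : multiplierDomain m) : mulFourier m (c • f) = c • mulFourier m f := by
  apply Lp.ext
  have h : (𝓕 ((c • f : multiplierDomain m) : L2 d) : L2 d) = c • (𝓕 (f : L2 d) : L2 d) :=
    FourierTransform.fourier_smul c (f : L2 d)
  have h₁ := coeFn_mulFourier m (c • f)
  rw [h] at h₁
  filter_upwards [h₁, coeFn_mulFourier m f, Lp.coeFn_smul c (mulFourier m f),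
    Lp.coeFn_smul c (𝓕 (f : L2 d) : L2 d)] with η e₁ e₂ e₃ e₄
  rw [e₁, e₃, e₄, Pi.smul_apply, Pi.smul_apply, e₂, smul_eq_mul, smul_eq_mul, mul_left_comm]

/-- The Fourier multiplier with real symbol `m`, which sends `f` to `𝓕⁻¹ (m · 𝓕 f)`, as an
unbounded operator on `L²(ℝ^d)` with its maximal domain. -/
def multiplier {d : ℕ} (m : EuclideanSpace ℝ (Fin d) → ℝ) : L2 d →ₗ.[ℂ] L2 d where
  domain := multiplierDomain m
  toFun :=
    { toFun := fun f => (𝓕⁻ (mulFourier m f) : L2 d)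
      map_add' := fun f g =>
        (congrArg (fun u : L2 d => (𝓕⁻ u : L2 d)) (mulFourier_add m f g)).trans
          (FourierTransform.fourierInv_add (mulFourier m f) (mulFourier m g))
      map_smul' := fun c f =>
        (congrArg (fun u : L2 d => (𝓕⁻ u : L2 d)) (mulFourier_smul m c f)).trans
          (FourierTransform.fourierInv_smul c (mulFourier m f)) }

/-! ### The operator `|D|^β / log^α (lam + |D|)` and its semigroup -/

/-- The symbol of `|D|^β / log^α (lam + |D|)` in the frequency variable `η = ξ / 2π` of Mathlib's
Fourier transform `𝓕 f η = ∫ exp (-2πi x·η) f x dx`, so that `|D|` has symbol `|ξ| = 2π|η|`. -/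
def symbol {d : ℕ} (α β lam : ℝ) (η : EuclideanSpace ℝ (Fin d)) : ℝ :=
  (2 * Real.pi * ‖η‖) ^ β / Real.log (lam + 2 * Real.pi * ‖η‖) ^ α

/-- The Fourier transform `e^{-t |ξ|^β / log^α (lam + |ξ|)}` of the kernel, with `ξ = 2πη`. -/
def kernelHat {d : ℕ} (α β lam t : ℝ) (η : EuclideanSpace ℝ (Fin d)) : ℂ :=
  (Real.exp (-(t * symbol α β lam η)) : ℂ)

/-- The kernel `K_t` on `ℝ^d`, for `t > 0`. -/
def kernel (d : ℕ) (α β lam t : ℝ) : EuclideanSpace ℝ (Fin d) → ℂ :=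
  𝓕⁻ (kernelHat α β lam t : EuclideanSpace ℝ (Fin d) → ℂ)

/-- `T` is the family `(e^{-tℒ})_{t ≥ 0}` on `L^p(ℝ^d)`, where `ℒ = |D|^β / log^α (lam + |D|)`:
`T 0 = Id`, and for `t > 0` the operator `T t` is the convolution with `K_t`. -/
def IsPropagator {d : ℕ} (α β lam : ℝ) (p : ℝ≥0∞) [Fact (1 ≤ p)]
    (T : ℝ≥0 → LpSpace d p →L[ℂ] LpSpace d p) : Prop :=
  T 0 = ContinuousLinearMap.id ℂ _ ∧
  ∀ t : ℝ≥0, 0 < t → ∀ f : LpSpace d p, ∀ᵐ x,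
    ConvolutionExistsAt (kernel d α β lam t) f x (ContinuousLinearMap.mul ℂ ℂ) volume ∧
    T t f x = (kernel d α β lam t ⋆[ContinuousLinearMap.mul ℂ ℂ, volume] f) x

end LogDissipation

end

noncomputable section

namespace LogDissipation

/-! ### The radial profile of the symbol -/

/-! Everything rests on `K_t` being a probability density; contraction, positivity and the L^∞ bound
are then facts about averages of translates. Since `exp(-t m)` is integrable and equals 1 at the
origin, the real content is `K_t ≥ 0`.

Positivity comes from an Askey-type criterion in dimension three. Suppose a profile ψ vanishes with
its derivative at infinity, ψ' ≤ 0, and ψ''(r)/r is nonnegative and nonincreasing. With ω(r) =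
ψ''(r)/(4πr), cutting space along the perpendicular bisector of 0 and b gives ∫ min(ω(|v|),
ω(|v-b|)) dv = ψ(|b|/2) for b ≠ 0 (`IsAskeyProfile.lintegral_min`). The layer-cake formula turns the
minimum into a superposition of autocorrelations of indicators, and the Fourier transform of an
autocorrelation is a squared modulus. In dimension one or two the missing variables become further
mixture parameters (`IsAskeyProfile.fourierInv_nonneg`).

For `exp(-t m)` the criterion follows once m' and -m'' are nonnegative, m' is nonincreasing and
-m''/r is nonincreasing. In terms of v = λ/(λ+r) and w = r/((λ+r) log(λ+r)) these are polynomial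
inequalities; they follow from 3w + 2αw ≤ β, which is what the lower bound on λ provides
(`logRatio_mul_le`, `curvature_polynomial_nonpos`).

A nonnegative inverse transform of a bounded integrable function is integrable, by testing against
wide Gaussians and Fatou. Fourier inversion then gives the mass of `K_t` and `K_s ⋆ K_t = K_{s+t}`.
Jensen's inequality and continuity of translations in L^p give the contraction semigroup.

On L², convolution with `K_t` is multiplication by `exp(-t m)` on the Fourier side
(`convLp_eq_boundedMultiplier`), which reduces self-adjointness, the square root and the generator
to statements about multiplication operators. The form inequality for |f| compares the bounded forms
t⁻¹(‖f‖² - Re⟨f, T_t f⟩): positivity of the kernel gives Re⟨f, T_t f⟩ ≤ ⟨|f|, T_t |f|⟩, and t → 0 is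
taken by Fatou. -/

/-- The symbol as a function of `r = |ξ|`. -/
def profile (α β lam r : ℝ) : ℝ := r ^ β / Real.log (lam + r) ^ α

/-- The quantity `lam / (lam + r)`. -/
def shiftRatio (lam r : ℝ) : ℝ := lam / (lam + r)

/-- The logarithmic derivative `r L' / L` of `L = log (lam + r)`. -/
def logRatio (lam r : ℝ) : ℝ := r / ((lam + r) * Real.log (lam + r))

/-- The logarithmic derivative `r m' / m` of the profile `m`. -/
def profileIndex (α β lam r : ℝ) : ℝ := β - α * logRatio lam r

/-- The ratio `- r² m'' / m` for the profile `m`. -/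
def profileCurvature (α β lam r : ℝ) : ℝ :=
  profileIndex α β lam r * (1 - profileIndex α β lam r) +
    α * (logRatio lam r * (shiftRatio lam r - logRatio lam r))

/-- The first derivative of the profile. -/
def profileDeriv (α β lam r : ℝ) : ℝ :=
  r ^ (β - 1) * Real.log (lam + r) ^ (-α) * profileIndex α β lam r

/-- Minus the second derivative of the profile. -/
def profileNegDeriv₂ (α β lam r : ℝ) : ℝ :=
  r ^ (β - 2) * Real.log (lam + r) ^ (-α) * profileCurvature α β lam r

/-- Writing the derivative of `g` as `g' / r` means working with the Euler operator r d/dr.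
Functions r^s L^(-α) g then keep their shape under differentiation, so one computation serves m',
m'' and the derivative of -m''/r. -/
theorem hasDerivAt_rpow_mul_log_rpow_mul {α lam r : ℝ} (s : ℝ) (hlam : 1 < lam) (hr : 0 < r)
    {g : ℝ → ℝ} {g' : ℝ} (hg : HasDerivAt g (g' / r) r) :
    HasDerivAt (fun r => r ^ s * Real.log (lam + r) ^ (-α) * g r)
      (r ^ (s - 1) * Real.log (lam + r) ^ (-α) * ((s - α * logRatio lam r) * g r + g')) r := by
  have hL : 0 < Real.log (lam + r) := Real.log_pos (by linarith)
  have h₁ : HasDerivAt (fun r : ℝ => r ^ s) (s * r ^ (s - 1)) r :=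
    Real.hasDerivAt_rpow_const (Or.inl hr.ne')
  have h₂ : HasDerivAt (fun r : ℝ => Real.log (lam + r)) (1 / (lam + r)) r :=
    ((hasDerivAt_id r).const_add lam).log (by simp only [id]; linarith)
  have h₃ := h₂.rpow_const (p := -α) (Or.inl hL.ne')
  refine ((h₁.mul h₃).mul hg).congr_deriv ?_
  simp only [Pi.mul_apply]
  rw [Real.rpow_sub_one hr.ne', Real.rpow_sub_one hL.ne', logRatio]
  have : lam + r ≠ 0 := by linarith
  field_simp
  ring

/-- With the next lemma this closes the system: r v' = -v(1-v) and r w' = w(v-w). All later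
derivatives are therefore polynomials in v, w, α and β, up to the common prefactor. -/
theorem hasDerivAt_shiftRatio {lam r : ℝ} (hlam : 1 < lam) (hr : 0 < r) :
    HasDerivAt (shiftRatio lam) (-(shiftRatio lam r * (1 - shiftRatio lam r)) / r) r := by
  have h : lam + r ≠ 0 := by linarith
  refine ((hasDerivAt_const r lam).div ((hasDerivAt_id r).const_add lam) h).congr_deriv ?_
  simp only [shiftRatio, id]
  field_simp
  ring

theorem hasDerivAt_logRatio {lam r : ℝ} (hlam : 1 < lam) (hr : 0 < r) :
    HasDerivAt (logRatio lam)
      (logRatio lam r * (shiftRatio lam r - logRatio lam r) / r) r := by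
  have h : lam + r ≠ 0 := by linarith
  have hL : 0 < Real.log (lam + r) := Real.log_pos (by linarith)
  have h₁ : HasDerivAt (fun r : ℝ => lam + r) 1 r := (hasDerivAt_id r).const_add lam
  refine ((hasDerivAt_id r).div (h₁.mul (h₁.log h)) (mul_ne_zero h hL.ne')).congr_deriv ?_
  simp only [shiftRatio, logRatio, id, Pi.mul_apply]
  field_simp
  ring

theorem hasDerivAt_profileIndex {α β lam r : ℝ} (hlam : 1 < lam) (hr : 0 < r) :
    HasDerivAt (profileIndex α β lam)
      (-(α * (logRatio lam r * (shiftRatio lam r - logRatio lam r))) / r) r := by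
  refine (((hasDerivAt_logRatio hlam hr).const_mul α).const_sub β).congr_deriv ?_
  ring

theorem hasDerivAt_profileCurvature {α β lam r : ℝ} (hlam : 1 < lam) (hr : 0 < r) :
    HasDerivAt (profileCurvature α β lam)
      ((-(α * (logRatio lam r * (shiftRatio lam r - logRatio lam r))) *
          (1 - 2 * profileIndex α β lam r) +
        α * logRatio lam r * ((shiftRatio lam r - logRatio lam r) ^ 2 -
          shiftRatio lam r * (1 - shiftRatio lam r) -
          logRatio lam r * (shiftRatio lam r - logRatio lam r))) / r) r := by
  have hq := hasDerivAt_profileIndex (α := α) (β := β) hlam hr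
  have hw := hasDerivAt_logRatio hlam hr
  have hv := hasDerivAt_shiftRatio hlam hr
  refine ((hq.mul (hq.const_sub 1)).add ((hw.mul (hv.sub hw)).const_mul α)).congr_deriv ?_
  simp only [Pi.sub_apply]
  ring

theorem hasDerivAt_profile {α β lam r : ℝ} (hlam : 1 < lam) (hr : 0 < r) :
    HasDerivAt (profile α β lam) (profileDeriv α β lam r) r := by
  have h := hasDerivAt_rpow_mul_log_rpow_mul (α := α) β hlam hr (g := fun _ => 1) (g' := 0)
    (by simpa using hasDerivAt_const r (1 : ℝ))
  have e : profileDeriv α β lam r = r ^ (β - 1) * Real.log (lam + r) ^ (-α) *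
      ((β - α * logRatio lam r) * 1 + 0) := by
    simp [profileDeriv, profileIndex]
  rw [e]
  refine h.congr_of_eventuallyEq ?_
  filter_upwards [lt_mem_nhds hr] with s hs
  rw [profile, mul_one, Real.rpow_neg (Real.log_pos (by linarith)).le, div_eq_mul_inv]

theorem hasDerivAt_profileDeriv {α β lam r : ℝ} (hlam : 1 < lam) (hr : 0 < r) :
    HasDerivAt (profileDeriv α β lam) (-profileNegDeriv₂ α β lam r) r := by
  refine (hasDerivAt_rpow_mul_log_rpow_mul (α := α) (β - 1) hlam hr
    (hasDerivAt_profileIndex (α := α) (β := β) hlam hr)).congr_deriv ?_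
  rw [profileNegDeriv₂, profileCurvature, profileIndex, show β - 1 - 1 = β - 2 by ring]
  ring

/-! ### Signs, monotonicity and growth of the profile and its derivatives -/

section Bounds

variable {α β lam r : ℝ}

theorem one_lt_of_exp_le (hα : 0 ≤ α) (hβ₀ : 0 < β) (hlam : Real.exp ((3 + 2 * α) / β) ≤ lam) :
    1 < lam :=
  (Real.one_lt_exp_iff.2 (by positivity)).trans_le hlam

theorem shiftRatio_pos (hlam : 1 < lam) (hr : 0 < r) : 0 < shiftRatio lam r := by
  unfold shiftRatio; positivity

theorem shiftRatio_le_one (hlam : 1 < lam) (hr : 0 < r) : shiftRatio lam r ≤ 1 := by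
  unfold shiftRatio
  rw [div_le_one (by positivity)]
  linarith

theorem logRatio_pos (hlam : 1 < lam) (hr : 0 < r) : 0 < logRatio lam r := by
  have hL : 0 < Real.log (lam + r) := Real.log_pos (by linarith)
  unfold logRatio; positivity

/-- Apart from `1 < lam`, this is the only use of the size of `lam`: w is at most 1/log(λ+r), hence
at most β/(3+2α). -/
theorem logRatio_mul_le (hα : 0 ≤ α) (hβ₀ : 0 < β) (hlam : Real.exp ((3 + 2 * α) / β) ≤ lam)
    (hr : 0 < r) : 3 * logRatio lam r + 2 * (α * logRatio lam r) ≤ β := by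
  have h1 := one_lt_of_exp_le hα hβ₀ hlam
  have hL : 0 < Real.log (lam + r) := Real.log_pos (by linarith)
  have hL' : (3 + 2 * α) / β ≤ Real.log (lam + r) := by
    rw [Real.le_log_iff_exp_le (by positivity)]; linarith
  have hw : logRatio lam r ≤ 1 / Real.log (lam + r) := by
    unfold logRatio
    rw [div_le_div_iff₀ (by positivity) hL]
    nlinarith
  have h3 : (3 + 2 * α) * (1 / Real.log (lam + r)) ≤ β := by
    rw [mul_one_div, div_le_iff₀ hL]
    rw [div_le_iff₀ hβ₀] at hL'
    linarith
  nlinarith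

theorem profileIndex_nonneg (hα : 0 ≤ α) (hβ₀ : 0 < β)
    (hlam : Real.exp ((3 + 2 * α) / β) ≤ lam) (hr : 0 < r) : 0 ≤ profileIndex α β lam r := by
  have h1 := one_lt_of_exp_le hα hβ₀ hlam
  have hw := logRatio_pos h1 hr
  have := logRatio_mul_le hα hβ₀ hlam hr
  have : 0 ≤ α * logRatio lam r := by positivity
  unfold profileIndex; linarith

/-- With a = αw and q = β - a, the curvature equals q(1-β) + a(β - a + v - w), and a + w ≤ β. -/
theorem profileCurvature_nonneg (hα : 0 ≤ α) (hβ₀ : 0 < β) (hβ₁ : β ≤ 1)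
    (hlam : Real.exp ((3 + 2 * α) / β) ≤ lam) (hr : 0 < r) :
    0 ≤ profileCurvature α β lam r := by
  have h1 := one_lt_of_exp_le hα hβ₀ hlam
  have hw := logRatio_pos h1 hr
  have hv := shiftRatio_pos h1 hr
  have h := logRatio_mul_le hα hβ₀ hlam hr
  have hq := profileIndex_nonneg hα hβ₀ hlam hr
  have ha : 0 ≤ α * logRatio lam r := by positivity
  unfold profileCurvature
  rw [← mul_assoc]
  unfold profileIndex at *
  set a := α * logRatio lam r
  set w := logRatio lam r
  set v := shiftRatio lam r
  have : 0 ≤ (β - a) * (1 - β) := mul_nonneg hq (by linarith)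
  have : 0 ≤ a * (β - a + v - w) := mul_nonneg ha (by linarith)
  nlinarith

/-- Up to a positive factor, the left side is the derivative of -m''/r: the exponent is β - 3, a
stands for αw, and the second summand is the Euler derivative of the curvature. -/
theorem curvature_polynomial_nonpos {a w v β : ℝ} (ha : 0 ≤ a) (hw : 0 ≤ w) (hv₀ : 0 ≤ v)
    (hv₁ : v ≤ 1) (hβ₁ : β ≤ 1) (h : 3 * w + 2 * a ≤ β) :
    (β - a - 3) * ((β - a) * (1 - (β - a)) + a * (v - w)) +
      (-(a * (v - w)) * (1 - 2 * (β - a)) +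
        a * ((v - w) ^ 2 - v * (1 - v) - w * (v - w))) ≤ 0 := by
  have hq : 0 ≤ (β - a) * (1 - β) := mul_nonneg (by linarith) (by linarith)
  have hp : 0 ≤ (β - a) * (1 - (β - a)) + a * (v - w) := by
    have : 0 ≤ a * (β - a + v - w) := mul_nonneg ha (by linarith)
    nlinarith
  -- With q = β - a and q - 3 replaced by -2, the negative of the left side is exactly 2q(1-β) + aB,
  -- where B is this expression. If w ≤ v, every term of B is nonnegative. If v < w, the negative
  -- terms have size at most 4w + 2w², while 2q ≥ 6w and w ≤ 1/3.
  have hb : 0 ≤ 2 * (β - a) * (1 - (v - w)) + 2 * (v - w) * (1 - (v - w)) + 2 * (v - w) +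
      w * (1 - v) := by
    have h₁ : 0 ≤ w * (1 - v) := mul_nonneg hw (by linarith)
    rcases le_total w v with hx | hx
    · have : 0 ≤ (β - a) * (1 - (v - w)) := mul_nonneg (by linarith) (by linarith)
      have : 0 ≤ (v - w) * (1 - (v - w)) := mul_nonneg (by linarith) (by linarith)
      linarith
    · nlinarith [mul_nonneg (sub_nonneg.2 hx) (show 0 ≤ β - a by linarith), mul_nonneg hw hv₀]
  have hp2 : (β - a - 3) * ((β - a) * (1 - (β - a)) + a * (v - w)) ≤
      -2 * ((β - a) * (1 - (β - a)) + a * (v - w)) := by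
    refine mul_le_mul_of_nonneg_right (by linarith) hp
  nlinarith [mul_nonneg ha hb]

theorem profileDeriv_nonneg (hα : 0 ≤ α) (hβ₀ : 0 < β)
    (hlam : Real.exp ((3 + 2 * α) / β) ≤ lam) (hr : 0 < r) : 0 ≤ profileDeriv α β lam r := by
  have h1 := one_lt_of_exp_le hα hβ₀ hlam
  have hL : 0 < Real.log (lam + r) := Real.log_pos (by linarith)
  have := profileIndex_nonneg hα hβ₀ hlam hr
  unfold profileDeriv; positivity

theorem profileNegDeriv₂_nonneg (hα : 0 ≤ α) (hβ₀ : 0 < β) (hβ₁ : β ≤ 1)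
    (hlam : Real.exp ((3 + 2 * α) / β) ≤ lam) (hr : 0 < r) :
    0 ≤ profileNegDeriv₂ α β lam r := by
  have h1 := one_lt_of_exp_le hα hβ₀ hlam
  have hL : 0 < Real.log (lam + r) := Real.log_pos (by linarith)
  have := profileCurvature_nonneg hα hβ₀ hβ₁ hlam hr
  unfold profileNegDeriv₂; positivity

theorem antitoneOn_Ioi_of_hasDerivAt {f f' : ℝ → ℝ} (hf : ∀ r, 0 < r → HasDerivAt f (f' r) r)
    (hf' : ∀ r, 0 < r → f' r ≤ 0) : AntitoneOn f (Set.Ioi 0) := by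
  refine antitoneOn_of_hasDerivWithinAt_nonpos (convex_Ioi 0)
    (fun r hr => (hf r hr).continuousAt.continuousWithinAt) (f' := f') ?_ ?_
  · intro r hr
    rw [interior_Ioi] at hr
    exact (hf r hr).hasDerivWithinAt
  · intro r hr
    rw [interior_Ioi] at hr
    exact hf' r hr

theorem profileDeriv_antitoneOn (hα : 0 ≤ α) (hβ₀ : 0 < β) (hβ₁ : β ≤ 1)
    (hlam : Real.exp ((3 + 2 * α) / β) ≤ lam) :
    AntitoneOn (profileDeriv α β lam) (Set.Ioi 0) :=
  antitoneOn_Ioi_of_hasDerivAt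
    (fun _ hr => hasDerivAt_profileDeriv (one_lt_of_exp_le hα hβ₀ hlam) hr)
    (fun _ hr => neg_nonpos.2 (profileNegDeriv₂_nonneg hα hβ₀ hβ₁ hlam hr))

theorem profileNegDeriv₂_div_antitoneOn (hα : 0 ≤ α) (hβ₀ : 0 < β) (hβ₁ : β ≤ 1)
    (hlam : Real.exp ((3 + 2 * α) / β) ≤ lam) :
    AntitoneOn (fun r => profileNegDeriv₂ α β lam r / r) (Set.Ioi 0) := by
  have h1 := one_lt_of_exp_le hα hβ₀ hlam
  -- Dividing by r lowers the exponent β - 2 to β - 3, which brings the quotient back to the form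
  -- handled by `hasDerivAt_rpow_mul_log_rpow_mul`.
  refine AntitoneOn.congr (f₁ := fun r => r ^ (β - 3) * Real.log (lam + r) ^ (-α) *
    profileCurvature α β lam r) (antitoneOn_Ioi_of_hasDerivAt (fun r hr =>
      hasDerivAt_rpow_mul_log_rpow_mul (α := α) (β - 3) h1 hr
        (hasDerivAt_profileCurvature (α := α) (β := β) h1 hr)) ?_) ?_
  · intro r hr
    have hL : 0 < Real.log (lam + r) := Real.log_pos (by linarith)
    refine mul_nonpos_of_nonneg_of_nonpos (by positivity) ?_
    have := curvature_polynomial_nonpos (mul_nonneg hα (logRatio_pos h1 hr).le)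
      (logRatio_pos h1 hr).le (shiftRatio_pos h1 hr).le (shiftRatio_le_one h1 hr) hβ₁
      (logRatio_mul_le hα hβ₀ hlam hr)
    refine le_of_eq_of_le ?_ this
    simp only [profileCurvature, profileIndex]
    ring
  · intro r hr
    have hr : 0 < r := hr
    simp only [profileNegDeriv₂]
    rw [show β - 3 = β - 2 - 1 by ring, Real.rpow_sub_one hr.ne']
    ring

theorem profile_nonneg (hlam : 1 < lam) (hr : 0 ≤ r) : 0 ≤ profile α β lam r := by
  have hL : 0 < Real.log (lam + r) := Real.log_pos (by linarith)
  unfold profile; positivity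

theorem profile_continuousOn (hβ₀ : 0 < β) (hlam : 1 < lam) :
    ContinuousOn (profile α β lam) (Set.Ici 0) := by
  intro r hr
  have hr : 0 ≤ r := hr
  have hL : 0 < Real.log (lam + r) := Real.log_pos (by linarith)
  refine ContinuousAt.continuousWithinAt ?_
  unfold profile
  refine (Real.continuousAt_rpow_const _ _ (Or.inr hβ₀.le)).div ?_ (by positivity)
  refine ContinuousAt.rpow_const ?_ (Or.inl hL.ne')
  exact (continuousAt_const.add continuousAt_id).log (by simpa using (by linarith : lam + r ≠ 0))

/-- The profile grows faster than any multiple of `log (1 + r)`. -/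
theorem eventually_mul_log_le_profile (hβ₀ : 0 < β) (hlam : 1 < lam) (N : ℝ) :
    ∀ᶠ r in atTop, N * Real.log (1 + r) ≤ profile α β lam r := by
  -- The exponent α + 1 leaves one logarithm over after division by log^α. The factor 2^β pays for
  -- (λ+r)^β ≤ (2r)^β when r ≥ λ, and |N| + 1 is positive and dominates N.
  have hc : 0 < 1 / ((|N| + 1) * 2 ^ β) := by positivity
  have h := ((isLittleO_log_rpow_rpow_atTop (α + 1) hβ₀).comp_tendsto
    (tendsto_atTop_add_const_left atTop lam tendsto_id)).bound hc
  filter_upwards [h, eventually_ge_atTop lam] with r h hr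
  simp only [Function.comp, id] at h
  have hr0 : 0 < r := by linarith
  have hL : 0 < Real.log (lam + r) := Real.log_pos (by linarith)
  rw [Real.norm_of_nonneg (by positivity), Real.norm_of_nonneg (by positivity),
    Real.rpow_add_one hL.ne'] at h
  have h2 : (lam + r) ^ β ≤ 2 ^ β * r ^ β := by
    rw [← Real.mul_rpow (by norm_num) hr0.le]
    exact Real.rpow_le_rpow (by linarith) (by linarith) hβ₀.le
  have h3 : (|N| + 1) * (Real.log (lam + r) ^ α * Real.log (lam + r)) ≤ r ^ β := by
    have h4 := h.trans (mul_le_mul_of_nonneg_left h2 hc.le)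
    have e : 1 / ((|N| + 1) * 2 ^ β) * (2 ^ β * r ^ β) = r ^ β / (|N| + 1) := by
      field_simp
    rw [e, le_div_iff₀ (by positivity)] at h4
    linarith
  rw [profile, le_div_iff₀ (by positivity)]
  have h5 : Real.log (1 + r) ≤ Real.log (lam + r) :=
    Real.log_le_log (by linarith) (by linarith)
  have h6 : 0 ≤ Real.log (1 + r) := Real.log_nonneg (by linarith)
  calc N * Real.log (1 + r) * Real.log (lam + r) ^ α
      ≤ (|N| + 1) * Real.log (lam + r) * Real.log (lam + r) ^ α := by
        gcongr
        linarith [le_abs_self N]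
    _ ≤ r ^ β := by linarith

theorem profile_tendsto_atTop (hβ₀ : 0 < β) (hlam : 1 < lam) :
    Tendsto (profile α β lam) atTop atTop := by
  have h : Tendsto (fun r : ℝ => 1 * Real.log (1 + r)) atTop atTop := by
    simpa [Function.comp_def] using
      Real.tendsto_log_atTop.comp (tendsto_atTop_add_const_left atTop 1 tendsto_id)
  exact tendsto_atTop_mono' _ (eventually_mul_log_le_profile hβ₀ hlam 1) h

end Bounds

/-! ### The radial profile of the Fourier transform of the kernel -/

/-- The function `exp (-t m(r))` for the profile `m`. -/
def decay (α β lam t r : ℝ) : ℝ := Real.exp (-(t * profile α β lam r))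

/-- The first derivative of `decay`. -/
def decayDeriv (α β lam t r : ℝ) : ℝ :=
  -(t * profileDeriv α β lam r) * decay α β lam t r

/-- The second derivative of `decay`. -/
def decayDeriv₂ (α β lam t r : ℝ) : ℝ :=
  (t ^ 2 * profileDeriv α β lam r ^ 2 + t * profileNegDeriv₂ α β lam r) * decay α β lam t r

section Decay

variable {α β lam t r : ℝ}

theorem hasDerivAt_decay (hlam : 1 < lam) (hr : 0 < r) :
    HasDerivAt (decay α β lam t) (decayDeriv α β lam t r) r := by
  refine (((hasDerivAt_profile (α := α) (β := β) hlam hr).const_mul t).neg).exp.congr_deriv ?_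
  simp only [Pi.neg_apply]
  rw [decayDeriv, decay]
  ring

theorem hasDerivAt_decayDeriv (hlam : 1 < lam) (hr : 0 < r) :
    HasDerivAt (decayDeriv α β lam t) (decayDeriv₂ α β lam t r) r := by
  refine ((((hasDerivAt_profileDeriv (α := α) (β := β) hlam hr).const_mul t).neg).mul
    (hasDerivAt_decay (α := α) (β := β) (t := t) hlam hr)).congr_deriv ?_
  simp only [Pi.neg_apply]
  rw [decayDeriv₂, decayDeriv]
  ring

theorem decayDeriv₂_nonneg (hα : 0 ≤ α) (hβ₀ : 0 < β) (hβ₁ : β ≤ 1)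
    (hlam : Real.exp ((3 + 2 * α) / β) ≤ lam) (ht : 0 < t) (hr : 0 < r) :
    0 ≤ decayDeriv₂ α β lam t r := by
  have := profileNegDeriv₂_nonneg hα hβ₀ hβ₁ hlam hr
  unfold decayDeriv₂ decay; positivity

theorem decay_antitoneOn (hα : 0 ≤ α) (hβ₀ : 0 < β)
    (hlam : Real.exp ((3 + 2 * α) / β) ≤ lam) (ht : 0 < t) :
    AntitoneOn (decay α β lam t) (Set.Ioi 0) :=
  antitoneOn_Ioi_of_hasDerivAt
    (fun _ hr => hasDerivAt_decay (one_lt_of_exp_le hα hβ₀ hlam) hr)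
    (fun _ hr => mul_nonpos_of_nonpos_of_nonneg
      (neg_nonpos.2 (mul_nonneg ht.le (profileDeriv_nonneg hα hβ₀ hlam hr))) (Real.exp_pos _).le)

/-- The quotient is (t² m'²/r + t(-m'')/r) exp(-t m), in which every factor is nonnegative and
nonincreasing. -/
theorem decayDeriv₂_div_antitoneOn (hα : 0 ≤ α) (hβ₀ : 0 < β) (hβ₁ : β ≤ 1)
    (hlam : Real.exp ((3 + 2 * α) / β) ≤ lam) (ht : 0 < t) :
    AntitoneOn (fun r => decayDeriv₂ α β lam t r / r) (Set.Ioi 0) := by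
  intro r hr s hs hrs
  have hr0 : 0 < r := hr
  have hs0 : 0 < s := hs
  have h₁ := profileDeriv_antitoneOn hα hβ₀ hβ₁ hlam hr hs hrs
  have h₂ := profileNegDeriv₂_div_antitoneOn hα hβ₀ hβ₁ hlam hr hs hrs
  have h₃ := decay_antitoneOn hα hβ₀ hlam ht hr hs hrs
  have p₁ := profileDeriv_nonneg hα hβ₀ hlam hs0
  have p₂ := profileNegDeriv₂_nonneg hα hβ₀ hβ₁ hlam hs0
  have p₃ := profileNegDeriv₂_nonneg hα hβ₀ hβ₁ hlam hr0
  have e : ∀ x : ℝ, decayDeriv₂ α β lam t x / x = (t ^ 2 * (profileDeriv α β lam x ^ 2 / x) +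
      t * (profileNegDeriv₂ α β lam x / x)) * decay α β lam t x := by
    intro x
    rw [decayDeriv₂]
    ring
  have p₄ : 0 ≤ decay α β lam t s := (Real.exp_pos _).le
  simp only [e]
  simp only at h₂
  gcongr

theorem decay_tendsto_zero (hβ₀ : 0 < β) (hlam : 1 < lam) (ht : 0 < t) :
    Tendsto (decay α β lam t) atTop (𝓝 0) :=
  Real.tendsto_exp_neg_atTop_nhds_zero.comp
    ((profile_tendsto_atTop hβ₀ hlam).const_mul_atTop ht)

/-- For r ≥ 1 the factor m' is at most m'(1), so the exponential alone forces the limit. -/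
theorem decayDeriv_tendsto_zero (hα : 0 ≤ α) (hβ₀ : 0 < β) (hβ₁ : β ≤ 1)
    (hlam : Real.exp ((3 + 2 * α) / β) ≤ lam) (ht : 0 < t) :
    Tendsto (decayDeriv α β lam t) atTop (𝓝 0) := by
  have h := (decay_tendsto_zero (α := α) hβ₀ (one_lt_of_exp_le hα hβ₀ hlam) ht).const_mul
    (t * profileDeriv α β lam 1)
  rw [mul_zero] at h
  refine squeeze_zero_norm' ?_ h
  filter_upwards [eventually_ge_atTop 1] with r hr
  have hr0 : 0 < r := by linarith
  have h₁ := profileDeriv_antitoneOn hα hβ₀ hβ₁ hlam (Set.mem_Ioi.2 one_pos)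
    (Set.mem_Ioi.2 hr0) hr
  have p₁ := profileDeriv_nonneg hα hβ₀ hlam hr0
  rw [decayDeriv, norm_mul, norm_neg, Real.norm_of_nonneg (by positivity),
    Real.norm_of_nonneg (show 0 ≤ decay α β lam t r from (Real.exp_pos _).le)]
  have : 0 ≤ decay α β lam t r := (Real.exp_pos _).le
  gcongr

/-! ### Continuity, boundedness and integrability of the transform of the kernel -/

theorem kernelHat_eq_decay {d : ℕ} (η : EuclideanSpace ℝ (Fin d)) :
    kernelHat α β lam t η = (decay α β lam t (2 * Real.pi * ‖η‖) : ℂ) := rfl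

theorem continuous_symbol {d : ℕ} (hβ₀ : 0 < β) (hlam : 1 < lam) :
    Continuous (symbol α β lam : EuclideanSpace ℝ (Fin d) → ℝ) :=
  (profile_continuousOn hβ₀ hlam).comp_continuous (by fun_prop)
    (fun η => by simp only [Set.mem_Ici]; positivity)

theorem symbol_nonneg {d : ℕ} (hlam : 1 < lam) (η : EuclideanSpace ℝ (Fin d)) :
    0 ≤ symbol α β lam η :=
  profile_nonneg hlam (by positivity)

theorem continuous_kernelHat {d : ℕ} (hβ₀ : 0 < β) (hlam : 1 < lam) :
    Continuous (kernelHat α β lam t : EuclideanSpace ℝ (Fin d) → ℂ) := by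
  have := continuous_symbol (d := d) (α := α) hβ₀ hlam
  unfold kernelHat
  fun_prop

theorem norm_kernelHat_le_one {d : ℕ} (hlam : 1 < lam) (ht : 0 ≤ t)
    (η : EuclideanSpace ℝ (Fin d)) : ‖kernelHat α β lam t η‖ ≤ 1 := by
  rw [kernelHat, Complex.norm_real, Real.norm_of_nonneg (Real.exp_pos _).le, Real.exp_le_one_iff]
  have := mul_nonneg ht (symbol_nonneg (α := α) (β := β) hlam η)
  linarith

theorem integrable_kernelHat {d : ℕ} (hβ₀ : 0 < β) (hlam : 1 < lam) (ht : 0 < t) :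
    Integrable (kernelHat α β lam t : EuclideanSpace ℝ (Fin d) → ℂ) := by
  have hint : Integrable (fun η : EuclideanSpace ℝ (Fin d) => (1 + ‖η‖) ^ (-((d : ℝ) + 1))) :=
    integrable_one_add_norm (by simp)
  refine LocallyIntegrable.integrable_of_isBigO_cocompact
    (continuous_kernelHat hβ₀ hlam).locallyIntegrable ?_ (hint.integrableAtFilter _)
  -- The multiple (d+1)/t of the logarithm is chosen so that exp(-t m) ≤ (1+‖η‖)^(-(d+1)) near
  -- infinity.
  have hev := (tendsto_norm_cocompact_atTop (E := EuclideanSpace ℝ (Fin d))).const_mul_atTop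
    (show 0 < 2 * Real.pi by positivity) |>.eventually
    (eventually_mul_log_le_profile (α := α) hβ₀ hlam (((d : ℝ) + 1) / t))
  refine Asymptotics.IsBigO.of_bound 1 ?_
  filter_upwards [hev] with η h
  have h2 : Real.log (1 + ‖η‖) ≤ Real.log (1 + 2 * Real.pi * ‖η‖) := by
    refine Real.log_le_log (by positivity) ?_
    nlinarith [norm_nonneg η, Real.pi_gt_three]
  rw [kernelHat_eq_decay, Complex.norm_real, decay, Real.norm_of_nonneg (Real.exp_pos _).le, one_mul,
    Real.norm_of_nonneg (by positivity), Real.rpow_def_of_pos (by positivity),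
    Real.exp_le_exp]
  have h3 : ((d : ℝ) + 1) / t * Real.log (1 + ‖η‖) ≤ profile α β lam (2 * Real.pi * ‖η‖) :=
    (mul_le_mul_of_nonneg_left h2 (by positivity)).trans h
  have h4 := mul_le_mul_of_nonneg_left h3 ht.le
  rw [← mul_assoc, mul_div_cancel₀ _ ht.ne'] at h4
  linarith

end Decay

/-! ### Mixtures of autocorrelations have a nonnegative Fourier transform -/

section Autocorrelation

variable {E : Type*} [NormedAddCommGroup E] [InnerProductSpace ℝ E] [MeasurableSpace E]
  [BorelSpace E] [FiniteDimensional ℝ E] {S : Type*} [MeasurableSpace S] {σ : Measure S}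
  [SFinite σ]

/-- If `Φ` is a superposition of the autocorrelations of the sections of a measurable set, then
its inverse Fourier transform is nonnegative. -/
theorem fourierInv_nonneg_of_eq_lintegral_autocorrelation {Φ : E → ℝ} (hΦ : Integrable Φ)
    (hΦ₀ : 0 ≤ Φ) {A : Set (S × E)} (hA : MeasurableSet A)
    (h : ∀ᵐ ξ, ENNReal.ofReal (Φ ξ) = ∫⁻ s, ∫⁻ y,
      A.indicator 1 (s, y) * A.indicator 1 (s, y - ξ) ∂volume ∂σ) (x : E) :
    0 ≤ 𝓕⁻ (fun ξ => (Φ ξ : ℂ)) x := by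
  set a : S → E → ℂ := fun s y => A.indicator 1 (s, y) with ha
  set c : S → E → ℂ := fun s y => (Real.fourierChar (inner ℝ y x) : ℂ) * a s y with hc
  have ham : Measurable (Function.uncurry a) := measurable_one.indicator hA
  have haE : ∀ s y, ‖a s y‖ₑ = A.indicator 1 (s, y) := by
    intro s y
    by_cases hs : (s, y) ∈ A <;> simp [ha, hs]
  have hstar : ∀ s y, star (a s y) = a s y := by
    intro s y
    by_cases hs : (s, y) ∈ A <;> simp [ha, hs]
  let H : E → S × E → ℂ := fun ξ q => a q.1 q.2 * a q.1 (q.2 - ξ)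
  have hHm : Measurable (Function.uncurry H) := by
    have h1 : Measurable fun z : E × S × E => a z.2.1 z.2.2 :=
      ham.comp (measurable_snd : Measurable fun z : E × S × E => z.2)
    have h2 : Measurable fun z : E × S × E => a z.2.1 (z.2.2 - z.1) :=
      ham.comp (f := fun z : E × S × E => (z.2.1, z.2.2 - z.1)) (by fun_prop)
    exact h1.mul h2
  have hHl : ∀ᵐ ξ, ∫⁻ q, ‖H ξ q‖ₑ ∂(σ.prod volume) = ENNReal.ofReal (Φ ξ) := by
    filter_upwards [h] with ξ hξ
    rw [hξ, lintegral_prod (fun q => ‖H ξ q‖ₑ)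
      (hHm.comp (measurable_prodMk_left (x := ξ))).enorm.aemeasurable]
    simp only [H, enorm_mul, haE]
  -- By Tonelli the total mass of `H` is the integral of `Φ`, so no finiteness of the individual
  -- sections of `A` has to be assumed.
  have hHi : Integrable (Function.uncurry H) (volume.prod (σ.prod volume)) := by
    refine ⟨hHm.aestronglyMeasurable, ?_⟩
    rw [HasFiniteIntegral, lintegral_prod _ hHm.enorm.aemeasurable]
    simp only [Function.uncurry]
    rw [lintegral_congr_ae hHl]
    have := hΦ.2
    rw [HasFiniteIntegral] at this
    refine lt_of_le_of_lt (lintegral_mono fun ξ => ?_) this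
    rw [← Real.enorm_of_nonneg (hΦ₀ ξ)]
  have hHint : ∀ᵐ ξ, (Φ ξ : ℂ) = ∫ q, H ξ q ∂(σ.prod volume) := by
    filter_upwards [hHl] with ξ hξ
    have e : ∀ q, H ξ q = ((‖H ξ q‖ : ℝ) : ℂ) := by
      intro q
      by_cases h1 : (q.1, q.2) ∈ A <;> by_cases h2 : (q.1, q.2 - ξ) ∈ A <;> simp [H, ha, h1, h2]
    rw [integral_congr_ae (Eventually.of_forall e), integral_complex_ofReal,
      integral_norm_eq_lintegral_enorm (f := H ξ)
        (hHm.comp (measurable_prodMk_left (x := ξ))).aestronglyMeasurable, hξ,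
      ENNReal.toReal_ofReal (hΦ₀ ξ)]
  have hKi : Integrable (Function.uncurry fun (ξ : E) (q : S × E) =>
      (Real.fourierChar (inner ℝ ξ x) : ℂ) * H ξ q) (volume.prod (σ.prod volume)) := by
    refine hHi.bdd_mul (c := 1) ?_ ?_
    · have : Continuous fun ξ : E => (Real.fourierChar (inner ℝ ξ x) : ℂ) := by fun_prop
      exact (this.measurable.comp measurable_fst).aestronglyMeasurable
    · exact Eventually.of_forall fun z => (Circle.norm_coe _).le
  -- Substituting ξ → y - ξ splits the character as e(⟨y,x⟩) times the conjugate of e(⟨ξ,x⟩). The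
  -- inner integral factors, and integrating over y leaves |∫ c|².
  have key : ∀ q : S × E, ∫ ξ, (Real.fourierChar (inner ℝ ξ x) : ℂ) * H ξ q =
      c q.1 q.2 * star (∫ y, c q.1 y) := by
    intro q
    have e1 : star (∫ y, c q.1 y) = ∫ y, star (c q.1 y) := (integral_conj).symm
    rw [e1, ← integral_const_mul, ← integral_sub_left_eq_self _ volume q.2]
    refine integral_congr_ae (Eventually.of_forall fun η => ?_)
    simp only [H, hc, sub_sub_cancel, star_mul', hstar]
    rw [inner_sub_left, AddChar.map_sub_eq_div, Circle.coe_div, div_eq_mul_inv,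
      ← Circle.coe_inv, Circle.coe_inv_eq_conj]
    simp only [RCLike.star_def]
    ring
  have hswap : 𝓕⁻ (fun ξ => (Φ ξ : ℂ)) x =
      ∫ s, (∫ y, c s y) * star (∫ y, c s y) ∂σ := by
    rw [Real.fourierInv_eq]
    calc ∫ ξ, Real.fourierChar (inner ℝ ξ x) • (Φ ξ : ℂ)
        = ∫ ξ, ∫ q, (Real.fourierChar (inner ℝ ξ x) : ℂ) * H ξ q ∂(σ.prod volume) := by
          refine integral_congr_ae ?_
          filter_upwards [hHint] with ξ hξ
          rw [integral_const_mul, ← hξ, Circle.smul_def, smul_eq_mul]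
      _ = ∫ q, (∫ ξ, (Real.fourierChar (inner ℝ ξ x) : ℂ) * H ξ q) ∂(σ.prod volume) :=
          integral_integral_swap hKi
      _ = ∫ q, c q.1 q.2 * star (∫ y, c q.1 y) ∂(σ.prod volume) := by simp_rw [key]
      _ = ∫ s, (∫ y, c s y * star (∫ y, c s y)) ∂σ := by
          refine integral_prod _ ?_
          have := hKi.integral_prod_right
          simpa only [Function.uncurry, key] using this
      _ = _ := by simp_rw [integral_mul_const]
  rw [hswap]
  have e : ∀ s, (∫ y, c s y) * star (∫ y, c s y) = ((‖∫ y, c s y‖ ^ 2 : ℝ) : ℂ) := by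
    intro s
    rw [RCLike.star_def, Complex.mul_conj, Complex.normSq_eq_norm_sq]
  simp_rw [e]
  rw [integral_complex_ofReal]
  exact_mod_cast integral_nonneg fun s => sq_nonneg _

end Autocorrelation

/-- The layer-cake formula for a minimum. -/
theorem lintegral_indicator_mul_indicator_eq_min (a b : ℝ≥0∞) :
    ∫⁻ τ : ℝ, {τ : ℝ | 0 < τ ∧ ENNReal.ofReal τ < a}.indicator 1 τ *
      {τ : ℝ | 0 < τ ∧ ENNReal.ofReal τ < b}.indicator 1 τ = min a b := by
  have key : ∀ c : ℝ≥0∞, volume {τ : ℝ | 0 < τ ∧ ENNReal.ofReal τ < c} = c := by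
    intro c
    induction c with
    | top =>
      have : {τ : ℝ | 0 < τ ∧ ENNReal.ofReal τ < ⊤} = Set.Ioi 0 := by ext; simp
      rw [this, Real.volume_Ioi]
    | coe c =>
      have : {τ : ℝ | 0 < τ ∧ ENNReal.ofReal τ < c} = Set.Ioo 0 (c : ℝ) := by
        ext τ
        simp only [Set.mem_ofPred_eq, Set.mem_Ioo, and_congr_right_iff]
        intro hτ
        rw [← ENNReal.ofReal_coe_nnreal, ENNReal.ofReal_lt_ofReal_iff_of_nonneg hτ.le]
      rw [this, Real.volume_Ioo, sub_zero, ENNReal.ofReal_coe_nnreal]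
  have hm : MeasurableSet {τ : ℝ | 0 < τ ∧ ENNReal.ofReal τ < min a b} :=
    (measurableSet_lt measurable_const measurable_id).inter
      (measurableSet_lt ENNReal.measurable_ofReal measurable_const)
  conv_rhs => rw [← key (min a b), ← lintegral_indicator_one hm]
  congr 1
  ext τ
  by_cases h0 : 0 < τ <;> by_cases h1 : ENNReal.ofReal τ < a <;>
    by_cases h2 : ENNReal.ofReal τ < b <;> simp [h0, h1, h2]

/-! ### Radial functions in dimension three -/

theorem lintegral_Ioi_ofReal_of_hasDerivAt {f f' : ℝ → ℝ} {a m : ℝ}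
    (hc : ContinuousWithinAt f (Set.Ici a) a) (hd : ∀ x ∈ Set.Ioi a, HasDerivAt f (f' x) x)
    (h₀ : ∀ x ∈ Set.Ioi a, 0 ≤ f' x) (hm : Tendsto f atTop (𝓝 m)) :
    ∫⁻ x in Set.Ioi a, ENNReal.ofReal (f' x) = ENNReal.ofReal (m - f a) := by
  rw [← integral_Ioi_of_hasDerivAt_of_nonneg hc hd h₀ hm,
    ofReal_integral_eq_lintegral_ofReal (integrableOn_Ioi_deriv_of_nonneg hc hd h₀ hm)]
  exact (ae_restrict_iff' measurableSet_Ioi).2 (Eventually.of_forall h₀)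

section ThreeDim

variable {V : Type*} [NormedAddCommGroup V] [InnerProductSpace ℝ V] [MeasurableSpace V]
  [BorelSpace V] [FiniteDimensional ℝ V]

/-- Polar coordinates in the plane for a function of the distance to the origin. -/
theorem lintegral_prod_sq_add_sq {f : ℝ → ℝ≥0∞} (hf : Measurable f) :
    ∫⁻ p : ℝ × ℝ, f (p.1 ^ 2 + p.2 ^ 2) =
      ∫⁻ r in Set.Ioi (0 : ℝ), ENNReal.ofReal (2 * Real.pi * r) * f (r ^ 2) := by
  rw [← lintegral_comp_polarCoord_symm]
  have e : ∀ p : ℝ × ℝ, ENNReal.ofReal p.1 • f ((polarCoord.symm p).1 ^ 2 +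
      (polarCoord.symm p).2 ^ 2) = ENNReal.ofReal p.1 * f (p.1 ^ 2) := by
    intro p
    rw [polarCoord_symm_apply, smul_eq_mul]
    congr 2
    linear_combination p.1 ^ 2 * Real.cos_sq_add_sin_sq p.2
  simp_rw [e]
  rw [polarCoord_target, Measure.volume_eq_prod, setLIntegral_prod _ (by fun_prop)]
  refine lintegral_congr fun r => ?_
  dsimp only
  rw [setLIntegral_const, Real.volume_Ioo, ENNReal.ofReal_mul (by positivity)]
  rw [show Real.pi - -Real.pi = 2 * Real.pi by ring]
  ring

/-- Integration of a function of `⟪v, e⟫` and `‖v‖` over a space of dimension three. -/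
theorem lintegral_inner_mul_norm (hV : Module.finrank ℝ V = 3) {e : V} (he : ‖e‖ = 1)
    {G f : ℝ → ℝ≥0∞} (hG : Measurable G) (hf : Measurable f) :
    ∫⁻ v : V, G (inner ℝ v e) * f ‖v‖ =
      ∫⁻ u : ℝ, G u * ∫⁻ r in Set.Ioi (0 : ℝ),
        ENNReal.ofReal (2 * Real.pi * r) * f √(u ^ 2 + r ^ 2) := by
  -- Completing e to an orthonormal basis with e as its first vector makes ⟪v, e⟫ a coordinate; the
  -- other two coordinates are then integrated in polar form.
  obtain ⟨b, hb⟩ := Orthonormal.exists_orthonormalBasis_extension_of_card_eq (𝕜 := ℝ)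
    (ι := Fin 3) (by simpa using hV) (v := fun _ => e) (s := {0}) (by
      rw [orthonormal_iff_ite]
      rintro ⟨i, rfl⟩ ⟨j, rfl⟩
      simp [he])
  have hb0 : b 0 = e := hb 0 rfl
  let Θ : V → ℝ × ℝ × ℝ := fun v => (b.repr v 0, b.repr v 1, b.repr v 2)
  have hΘ : MeasurePreserving Θ volume volume := by
    have h1 := b.measurePreserving_repr
    have h2 := PiLp.volume_preserving_ofLp (Fin 3)
    have h3 := volume_preserving_piFinSuccAbove (fun _ : Fin 3 => ℝ) 0
    have h4 : MeasurePreserving (Prod.map (id : ℝ → ℝ) (MeasurableEquiv.finTwoArrow (α := ℝ)))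
        volume volume := (MeasurePreserving.id volume).prod (volume_preserving_finTwoArrow ℝ)
    exact h4.comp (h3.comp (h2.comp h1))
  let F : ℝ × ℝ × ℝ → ℝ≥0∞ := fun p => G p.1 * f √(p.1 ^ 2 + (p.2.1 ^ 2 + p.2.2 ^ 2))
  have hF : Measurable F := by fun_prop
  have e1 : ∀ v : V, G (inner ℝ v e) * f ‖v‖ = F (Θ v) := by
    intro v
    have e2 : ‖v‖ = √(b.repr v 0 ^ 2 + (b.repr v 1 ^ 2 + b.repr v 2 ^ 2)) := by
      rw [← b.repr.norm_map v, EuclideanSpace.norm_eq, Fin.sum_univ_three]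
      simp only [Real.norm_eq_abs, sq_abs, add_assoc]
    simp only [F, Θ, e2]
    rw [← hb0, real_inner_comm, b.repr_apply_apply]
  simp_rw [e1]
  rw [hΘ.lintegral_comp hF, Measure.volume_eq_prod, lintegral_prod _ hF.aemeasurable]
  refine lintegral_congr fun u => ?_
  simp only [F]
  rw [lintegral_const_mul _ (by fun_prop)]
  congr 1
  exact lintegral_prod_sq_add_sq (f := fun s => f √(u ^ 2 + s)) (by fun_prop)

/-- The data of a function `ψ` on `(0, ∞)` such that `ψ'' (r) / r` is nonnegative and
nonincreasing. -/
structure IsAskeyProfile (ψ ψ₁ ψ₂ : ℝ → ℝ) : Prop where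
  hasDerivAt : ∀ r, 0 < r → HasDerivAt ψ (ψ₁ r) r
  hasDerivAt₂ : ∀ r, 0 < r → HasDerivAt ψ₁ (ψ₂ r) r
  deriv_nonpos : ∀ r, 0 < r → ψ₁ r ≤ 0
  deriv₂_nonneg : ∀ r, 0 < r → 0 ≤ ψ₂ r
  antitoneOn : AntitoneOn (fun r => ψ₂ r / r) (Set.Ioi 0)
  tendsto : Tendsto ψ atTop (𝓝 0)
  tendsto_deriv : Tendsto ψ₁ atTop (𝓝 0)

/-- The density `ψ''(r) / (4 π r)`. -/
def askeyDensity (ψ₂ : ℝ → ℝ) (r : ℝ) : ℝ≥0∞ :=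
  -- The value `⊤` for r ≤ 0 makes the density antitone on the whole line, hence measurable.
  if 0 < r then ENNReal.ofReal (ψ₂ r / r / (4 * Real.pi)) else ⊤

variable {ψ ψ₁ ψ₂ : ℝ → ℝ}

theorem IsAskeyProfile.antitone_density (h : IsAskeyProfile ψ ψ₁ ψ₂) :
    Antitone (askeyDensity ψ₂) := by
  intro r s hrs
  unfold askeyDensity
  by_cases hr : 0 < r
  · have hs : 0 < s := hr.trans_le hrs
    rw [if_pos hr, if_pos hs]
    refine ENNReal.ofReal_le_ofReal ?_
    gcongr ?_ / _
    exact h.antitoneOn hr hs hrs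
  · rw [if_neg hr]
    exact le_top

/-- This is the integral of the density over the plane at height u. With ρ = √(u²+r²), the weight
2πr turns ψ''(ρ)/(4πρ) into the exact r-derivative of ψ'(ρ)/2; the normalisation 4πr is made for
this. -/
theorem IsAskeyProfile.lintegral_density (h : IsAskeyProfile ψ ψ₁ ψ₂) {u : ℝ} (hu : u ≠ 0) :
    ∫⁻ r in Set.Ioi (0 : ℝ), ENNReal.ofReal (2 * Real.pi * r) *
      askeyDensity ψ₂ √(u ^ 2 + r ^ 2) = ENNReal.ofReal (-ψ₁ |u| / 2) := by
  have hρ : ∀ r : ℝ, 0 < √(u ^ 2 + r ^ 2) := fun r => by positivity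
  have hd : ∀ r : ℝ, HasDerivAt (fun r => ψ₁ √(u ^ 2 + r ^ 2) / 2)
      (ψ₂ √(u ^ 2 + r ^ 2) * (r / √(u ^ 2 + r ^ 2)) / 2) r := by
    intro r
    have h1 : HasDerivAt (fun r : ℝ => √(u ^ 2 + r ^ 2)) (r / √(u ^ 2 + r ^ 2)) r := by
      have := ((hasDerivAt_pow 2 r).const_add (u ^ 2)).sqrt (by positivity)
      refine this.congr_deriv ?_
      have := (hρ r).ne'
      field_simp
      norm_num
    exact ((h.hasDerivAt₂ _ (hρ r)).comp r h1).div_const 2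
  have ht : Tendsto (fun r => ψ₁ √(u ^ 2 + r ^ 2) / 2) atTop (𝓝 (0 / 2)) := by
    refine (h.tendsto_deriv.comp ?_).div_const 2
    refine tendsto_atTop_mono (fun r => ?_) tendsto_id
    exact Real.le_sqrt_of_sq_le (by simp only [id]; nlinarith [sq_nonneg u])
  have := lintegral_Ioi_ofReal_of_hasDerivAt (a := 0) (hd 0).continuousAt.continuousWithinAt
    (fun r _ => hd r) (fun r hr => by
      have hr : 0 < r := hr
      have := h.deriv₂_nonneg _ (hρ r)
      positivity) ht
  rw [show -ψ₁ |u| / 2 = 0 / 2 - ψ₁ √(u ^ 2 + 0 ^ 2) / 2 by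
    rw [zero_pow two_ne_zero, add_zero, Real.sqrt_sq_eq_abs]; ring, ← this]
  refine setLIntegral_congr_fun measurableSet_Ioi fun r hr => ?_
  have hr : 0 < r := hr
  rw [askeyDensity, if_pos (hρ r), ← ENNReal.ofReal_mul (by positivity)]
  congr 1
  have := (hρ r).ne'
  field_simp
  ring

/-- Slicing by planes orthogonal to e leaves the integral of -ψ'/2 over (a, ∞). -/
theorem IsAskeyProfile.lintegral_halfSpace (h : IsAskeyProfile ψ ψ₁ ψ₂)
    (hV : Module.finrank ℝ V = 3) {e : V} (he : ‖e‖ = 1) {a : ℝ} (ha : 0 < a) :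
    ∫⁻ v : V, (Set.Ioi a).indicator 1 (inner ℝ v e) * askeyDensity ψ₂ ‖v‖ =
      ENNReal.ofReal (ψ a / 2) := by
  rw [lintegral_inner_mul_norm hV he (measurable_one.indicator measurableSet_Ioi)
    h.antitone_density.measurable]
  have hd := lintegral_Ioi_ofReal_of_hasDerivAt (f := fun u => -ψ u / 2)
    (f' := fun u => -ψ₁ u / 2) (a := a) (m := -0 / 2)
    ((h.hasDerivAt a ha).neg.div_const 2).continuousAt.continuousWithinAt
    (fun u hu => (h.hasDerivAt u (ha.trans hu)).neg.div_const 2)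
    (fun u hu => by have := h.deriv_nonpos u (ha.trans hu); linarith)
    (h.tendsto.neg.div_const 2)
  rw [show ψ a / 2 = -0 / 2 - -ψ a / 2 by ring, ← hd, ← lintegral_indicator measurableSet_Ioi]
  refine lintegral_congr fun u => ?_
  by_cases hu : u ∈ Set.Ioi a
  · have hu0 : 0 < u := ha.trans hu
    simp only [Set.indicator_of_mem hu, Pi.one_apply, one_mul]
    rw [h.lintegral_density hu0.ne', abs_of_pos hu0]
  · simp only [Set.indicator_of_notMem hu, zero_mul]

/-- The bounding plane is null. The closed version is needed because a partition of the space
consists of one open and one closed half-space. -/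
theorem IsAskeyProfile.lintegral_closedHalfSpace (h : IsAskeyProfile ψ ψ₁ ψ₂)
    (hV : Module.finrank ℝ V = 3) {e : V} (he : ‖e‖ = 1) {a : ℝ} (ha : 0 < a) :
    ∫⁻ v : V, (Set.Ici a).indicator 1 (inner ℝ v e) * askeyDensity ψ₂ ‖v‖ =
      ENNReal.ofReal (ψ a / 2) := by
  rw [← h.lintegral_halfSpace hV he ha,
    lintegral_inner_mul_norm hV he (measurable_one.indicator measurableSet_Ici)
      h.antitone_density.measurable,
    lintegral_inner_mul_norm hV he (measurable_one.indicator measurableSet_Ioi)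
      h.antitone_density.measurable]
  refine lintegral_congr_ae ?_
  filter_upwards [indicator_ae_eq_of_ae_eq_set (f := (1 : ℝ → ℝ≥0∞))
    (Ioi_ae_eq_Ici (a := a) (μ := volume))] with u hu
  rw [hu]

/-- A radial function whose profile satisfies the Askey condition is a minimum-convolution. -/
theorem IsAskeyProfile.lintegral_min (h : IsAskeyProfile ψ ψ₁ ψ₂)
    (hV : Module.finrank ℝ V = 3) (hψ : ∀ r, 0 < r → 0 ≤ ψ r) {b : V} (hb : b ≠ 0) :
    ∫⁻ v : V, min (askeyDensity ψ₂ ‖v‖) (askeyDensity ψ₂ ‖v - b‖) =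
      ENNReal.ofReal (ψ (‖b‖ / 2)) := by
  have hb0 : 0 < ‖b‖ := norm_pos_iff.2 hb
  have ha : 0 < ‖b‖ / 2 := by positivity
  set e : V := ‖b‖⁻¹ • b with he_def
  have he : ‖e‖ = 1 := by rw [he_def, norm_smul, norm_inv, norm_norm, inv_mul_cancel₀ hb0.ne']
  have hin : ∀ v, inner ℝ v b = ‖b‖ * inner ℝ v e := by
    intro v
    rw [he_def, inner_smul_right, mul_inv_cancel_left₀ hb0.ne']
  have hsq : ∀ v, ‖v - b‖ ^ 2 = ‖v‖ ^ 2 - 2 * (‖b‖ * inner ℝ v e) + ‖b‖ ^ 2 := by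
    intro v
    rw [norm_sub_sq_real, hin]
  -- The perpendicular bisector of 0 and b decides the minimum: the density is antitone, so the
  -- smaller value belongs to the more distant of the two centres. The reflection v ↦ b - v carries
  -- one half onto the other up to the boundary, so each contributes ψ(‖b‖/2)/2.
  have hsplit : ∀ v : V, min (askeyDensity ψ₂ ‖v‖) (askeyDensity ψ₂ ‖v - b‖) =
      (Set.Ioi (‖b‖ / 2)).indicator 1 (inner ℝ v e) * askeyDensity ψ₂ ‖v‖ +
      (Set.Ici (‖b‖ / 2)).indicator 1 (inner ℝ (b - v) e) * askeyDensity ψ₂ ‖b - v‖ := by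
    intro v
    have hbe : inner ℝ (b - v) e = ‖b‖ - inner ℝ v e := by
      rw [inner_sub_left, he_def, inner_smul_right, real_inner_self_eq_norm_sq]
      field_simp
    rw [norm_sub_rev b v, hbe]
    by_cases hv : ‖b‖ / 2 < inner ℝ v e
    · have h1 : ‖v - b‖ ≤ ‖v‖ := by
        refine le_of_sq_le_sq ?_ (norm_nonneg _)
        rw [hsq]
        nlinarith
      rw [Set.indicator_of_mem (show inner ℝ v e ∈ Set.Ioi (‖b‖ / 2) from hv),
        Set.indicator_of_notMem (by simp only [Set.mem_Ici, not_le]; linarith),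
        min_eq_left (h.antitone_density h1)]
      simp
    · have h1 : ‖v‖ ≤ ‖v - b‖ := by
        refine le_of_sq_le_sq ?_ (norm_nonneg _)
        rw [hsq]
        nlinarith
      rw [Set.indicator_of_notMem (show inner ℝ v e ∉ Set.Ioi (‖b‖ / 2) from hv),
        Set.indicator_of_mem (by simp only [Set.mem_Ici]; linarith),
        min_eq_right (h.antitone_density h1)]
      simp
  have hm := h.antitone_density.measurable
  have hm1 : Measurable fun v : V => (Set.Ioi (‖b‖ / 2)).indicator 1 (inner ℝ v e) *
      askeyDensity ψ₂ ‖v‖ :=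
    ((measurable_one.indicator measurableSet_Ioi).comp (by fun_prop)).mul
      (hm.comp measurable_norm)
  simp_rw [hsplit]
  rw [lintegral_add_left hm1, lintegral_sub_left_eq_self
    (fun v : V => (Set.Ici (‖b‖ / 2)).indicator 1 (inner ℝ v e) * askeyDensity ψ₂ ‖v‖) b,
    h.lintegral_halfSpace hV he ha, h.lintegral_closedHalfSpace hV he ha,
    ← ENNReal.ofReal_add (by have := hψ _ ha; positivity) (by have := hψ _ ha; positivity),
    add_halves]

end ThreeDim

/-- In dimension at most three, a radial function whose profile satisfies the Askey condition has
a nonnegative inverse Fourier transform. -/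
theorem IsAskeyProfile.fourierInv_nonneg {E : Type*} [NormedAddCommGroup E]
    [InnerProductSpace ℝ E] [MeasurableSpace E] [BorelSpace E] [FiniteDimensional ℝ E]
    [Nontrivial E] {ψ ψ₁ ψ₂ : ℝ → ℝ} (h : IsAskeyProfile ψ ψ₁ ψ₂)
    (hE : Module.finrank ℝ E ≤ 3) (hψ : ∀ r, 0 ≤ r → 0 ≤ ψ r)
    (hi : Integrable fun ξ : E => ψ (‖ξ‖ / 2)) (x : E) :
    0 ≤ 𝓕⁻ (fun ξ : E => (ψ (‖ξ‖ / 2) : ℂ)) x := by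
  -- Padding with the missing dimensions places E in a space of dimension exactly three, where the
  -- minimum formula is available.
  let F := EuclideanSpace ℝ (Fin (3 - Module.finrank ℝ E))
  have hV : Module.finrank ℝ (WithLp 2 (E × F)) = 3 := by
    rw [LinearEquiv.finrank_eq (WithLp.linearEquiv 2 ℝ (E × F)), Module.finrank_prod,
      finrank_euclideanSpace_fin]
    omega
  let Ω : E × F → ℝ≥0∞ := fun p => askeyDensity ψ₂ ‖WithLp.toLp 2 p‖
  have hΩ : Measurable Ω :=
    h.antitone_density.measurable.comp
      (measurable_norm.comp (WithLp.measurable_toLp 2 (E × F)))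
  -- The subgraph of the density, sectioned by the padding variable and the layer height. A shift by
  -- (ξ, 0) leaves both parameters fixed, so the three-dimensional formula becomes a superposition
  -- of autocorrelations on E.
  let A : Set ((F × ℝ) × E) := {q | 0 < q.1.2 ∧ ENNReal.ofReal q.1.2 < Ω (q.2, q.1.1)}
  have hA : MeasurableSet A := by
    refine MeasurableSet.inter ?_ ?_
    · exact measurableSet_lt measurable_const (measurable_snd.comp measurable_fst)
    · exact measurableSet_lt (f := fun q : (F × ℝ) × E => ENNReal.ofReal q.1.2)
        (g := fun q : (F × ℝ) × E => Ω (q.2, q.1.1)) (by fun_prop) (by fun_prop)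
  refine fourierInv_nonneg_of_eq_lintegral_autocorrelation (Φ := fun ξ => ψ (‖ξ‖ / 2)) hi
    (fun ξ => hψ _ (by positivity)) (σ := (volume : Measure (F × ℝ))) hA ?_ x
  filter_upwards [Measure.ae_ne volume (0 : E)] with ξ hξ
  have hb : WithLp.toLp 2 ((ξ, 0) : E × F) ≠ 0 := by
    intro h0
    exact hξ (congrArg Prod.fst ((WithLp.toLp_eq_zero 2).1 h0))
  have hn : ‖WithLp.toLp 2 ((ξ, 0) : E × F)‖ = ‖ξ‖ := by
    rw [WithLp.prod_norm_eq_of_L2]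
    simp
  have h1 := h.lintegral_min hV (fun r hr => hψ r hr.le) hb
  rw [hn] at h1
  rw [← h1, ← (WithLp.volume_preserving_toLp E F).lintegral_comp (by
    have := h.antitone_density.measurable
    fun_prop)]
  have hmin : ∀ p : E × F, min (askeyDensity ψ₂ ‖WithLp.toLp 2 p‖)
      (askeyDensity ψ₂ ‖WithLp.toLp 2 p - WithLp.toLp 2 ((ξ, 0) : E × F)‖) =
      ∫⁻ τ : ℝ, A.indicator 1 ((p.2, τ), p.1) * A.indicator 1 ((p.2, τ), p.1 - ξ) := by
    intro p
    rw [← lintegral_indicator_mul_indicator_eq_min, ← WithLp.toLp_sub]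
    have e : p - (ξ, 0) = (p.1 - ξ, p.2) := by ext <;> simp
    rw [e]
    rfl
  simp_rw [hmin]
  have hmeas : Measurable fun z : (E × F) × ℝ =>
      A.indicator (1 : (F × ℝ) × E → ℝ≥0∞) ((z.1.2, z.2), z.1.1) *
        A.indicator 1 ((z.1.2, z.2), z.1.1 - ξ) :=
    ((measurable_one.indicator hA).comp (by fun_prop)).mul
      ((measurable_one.indicator hA).comp (by fun_prop))
  have hmeas' : Measurable fun z : (F × ℝ) × E =>
      A.indicator (1 : (F × ℝ) × E → ℝ≥0∞) (z.1, z.2) * A.indicator 1 (z.1, z.2 - ξ) :=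
    ((measurable_one.indicator hA).comp (by fun_prop)).mul
      ((measurable_one.indicator hA).comp (by fun_prop))
  rw [Measure.volume_eq_prod, Measure.volume_eq_prod,
    lintegral_prod_symm _ hmeas.lintegral_prod_right'.aemeasurable,
    lintegral_prod _ hmeas'.lintegral_prod_right'.aemeasurable]
  refine lintegral_congr fun z => ?_
  refine lintegral_lintegral_swap ?_
  exact (hmeas'.comp (f := fun w : E × ℝ => ((z, w.2), w.1)) (by fun_prop)).aemeasurable

/-! ### Integrability of nonnegative inverse Fourier transforms -/

section Gauss

variable {V : Type*} [NormedAddCommGroup V]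

/-- The Gaussian `exp (-b |v|²)`. -/
def gauss (V : Type*) [NormedAddCommGroup V] (b : ℝ) (v : V) : ℂ := Complex.exp (-b * ‖v‖ ^ 2)

theorem gauss_eq_ofReal (b : ℝ) (v : V) : gauss V b v = (Real.exp (-b * ‖v‖ ^ 2) : ℂ) := by
  rw [gauss]
  push_cast
  rfl

theorem norm_gauss (b : ℝ) (v : V) : ‖gauss V b v‖ = Real.exp (-b * ‖v‖ ^ 2) := by
  rw [gauss_eq_ofReal, Complex.norm_real, Real.norm_of_nonneg (Real.exp_pos _).le]

theorem continuous_gauss (b : ℝ) : Continuous (gauss V b) := by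
  unfold gauss
  fun_prop

variable [InnerProductSpace ℝ V] [MeasurableSpace V]
  [BorelSpace V] [FiniteDimensional ℝ V]

theorem integrable_gauss {b : ℝ} (hb : 0 < b) : Integrable (gauss V b) := by
  have := GaussianFourier.integrable_cexp_neg_mul_sq_norm_add (b := (b : ℂ))
    (by simpa using hb) 0 (0 : V)
  exact this.congr (Eventually.of_forall fun v => by simp [gauss])

theorem fourier_gauss {b : ℝ} (hb : 0 < b) (w : V) :
    𝓕 (gauss V b) w =
      (((Real.pi / b) ^ (Module.finrank ℝ V / 2 : ℝ) : ℝ) : ℂ) * gauss V (Real.pi ^ 2 / b) w := by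
  have h := fourier_gaussian_innerProductSpace (b := (b : ℂ)) (by simpa using hb) w
  unfold gauss
  rw [h, Complex.ofReal_cpow (by positivity)]
  push_cast
  congr 2
  ring

theorem fourier_gauss_nonneg {b : ℝ} (hb : 0 < b) (w : V) : 0 ≤ 𝓕 (gauss V b) w := by
  rw [fourier_gauss hb, gauss_eq_ofReal]
  norm_cast
  positivity

theorem integrable_fourier_gauss {b : ℝ} (hb : 0 < b) : Integrable (𝓕 (gauss V b)) := by
  rw [funext (fourier_gauss hb)]
  exact (integrable_gauss (by positivity)).const_mul _

/-- Fourier inversion at the origin, where the Gaussian equals 1. -/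
theorem integral_fourier_gauss {b : ℝ} (hb : 0 < b) : ∫ w, 𝓕 (gauss V b) w = 1 := by
  have h := congrFun (Continuous.fourierInv_fourier_eq (continuous_gauss (V := V) b)
    (integrable_gauss hb) (integrable_fourier_gauss hb)) 0
  simpa [Real.fourierInv_eq, gauss] using h

theorem integral_norm_fourier_gauss {b : ℝ} (hb : 0 < b) : ∫ w, ‖𝓕 (gauss V b) w‖ = 1 := by
  have h := integral_fourier_gauss (V := V) hb
  have e : ∀ w, 𝓕 (gauss V b) w = ((‖𝓕 (gauss V b) w‖ : ℝ) : ℂ) := fun w =>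
    (Complex.norm_of_nonneg' (fourier_gauss_nonneg hb w)).symm
  rw [integral_congr_ae (Eventually.of_forall e), integral_complex_ofReal] at h
  exact_mod_cast h

/-- The multiplication formula against a Gaussian. -/
theorem integral_fourierInv_mul_gauss {Φ : V → ℂ} (hΦ : Integrable Φ) {b : ℝ} (hb : 0 < b) :
    ∫ x, 𝓕⁻ Φ x * gauss V b x = ∫ ξ, Φ ξ * 𝓕 (gauss V b) ξ := by
  have h := VectorFourier.integral_fourierIntegral_smul_eq_flip (L := innerₗ V)
    Real.continuous_fourierChar continuous_inner hΦ (integrable_gauss hb)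
  have h' : ∫ x, 𝓕 Φ x * gauss V b x = ∫ ξ, Φ ξ * 𝓕 (gauss V b) ξ := by
    simpa using! h
  rw [← h', ← integral_neg_eq_self (fun x => 𝓕 Φ x * gauss V b x)]
  refine integral_congr_ae (Eventually.of_forall fun x => ?_)
  simp only [Real.fourierInv_eq_fourier_neg, gauss, norm_neg]

theorem continuous_fourierInv {Φ : V → ℂ} (hΦ : Integrable Φ) : Continuous (𝓕⁻ Φ) := by
  have h : Continuous (𝓕 Φ) := VectorFourier.fourierIntegral_continuous
    Real.continuous_fourierChar (L := innerₗ V) continuous_inner hΦ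
  have e : 𝓕⁻ Φ = fun x => 𝓕 Φ (-x) := funext (Real.fourierInv_eq_fourier_neg Φ)
  rw [e]
  exact h.comp continuous_neg

theorem norm_fourierInv_le (Φ : V → ℂ) (x : V) : ‖𝓕⁻ Φ x‖ ≤ ∫ ξ, ‖Φ ξ‖ := by
  rw [Real.fourierInv_eq]
  refine (norm_integral_le_integral_norm _).trans_eq ?_
  simp only [Circle.norm_smul]

theorem integrable_fourierInv_mul_gauss {Φ : V → ℂ} (hΦ : Integrable Φ) {b : ℝ} (hb : 0 < b) :
    Integrable fun x => 𝓕⁻ Φ x * gauss V b x :=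
  (integrable_gauss hb).bdd_mul (continuous_fourierInv hΦ).aestronglyMeasurable
    (Eventually.of_forall (norm_fourierInv_le Φ))

/-- A nonnegative inverse Fourier transform of a bounded function is integrable. -/
theorem integrable_fourierInv_of_nonneg {Φ : V → ℂ} (hΦ : Integrable Φ) (hb : ∀ ξ, ‖Φ ξ‖ ≤ 1)
    (h₀ : ∀ x, 0 ≤ 𝓕⁻ Φ x) : Integrable (𝓕⁻ Φ) := by
  refine ⟨(continuous_fourierInv hΦ).aestronglyMeasurable, ?_⟩
  let b : ℕ → ℝ := fun n => 1 / ((n : ℝ) + 1)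
  have hb0 : ∀ n, 0 < b n := fun n => by positivity
  have hbt : Tendsto b atTop (𝓝 0) := tendsto_one_div_add_atTop_nhds_zero_nat
  have hlim : ∀ x, Tendsto (fun n => ‖𝓕⁻ Φ x * gauss V (b n) x‖ₑ) atTop (𝓝 ‖𝓕⁻ Φ x‖ₑ) := by
    intro x
    have h1 : Tendsto (fun n => gauss V (b n) x) atTop (𝓝 (Complex.exp (-(0 : ℝ) * ‖x‖ ^ 2))) :=
      ((((Complex.continuous_ofReal.tendsto 0).comp hbt).neg).mul_const _).cexp
    have h2 := (h1.const_mul (𝓕⁻ Φ x)).enorm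
    simpa using h2
  -- The multiplication formula replaces the left side by the pairing of `Φ` with the transform of
  -- the Gaussian, which is a probability density; the bound on `Φ` gives 1, uniformly in n.
  have hle : ∀ n, ∫⁻ x, ‖𝓕⁻ Φ x * gauss V (b n) x‖ₑ ≤ 1 := by
    intro n
    have hint := integrable_fourierInv_mul_gauss hΦ (hb0 n)
    have hnn : ∀ x, 0 ≤ 𝓕⁻ Φ x * gauss V (b n) x := fun x => by
      refine mul_nonneg (h₀ x) ?_
      rw [gauss_eq_ofReal]
      exact_mod_cast (Real.exp_pos _).le
    have e : ∫ x, ‖𝓕⁻ Φ x * gauss V (b n) x‖ = ‖∫ x, 𝓕⁻ Φ x * gauss V (b n) x‖ := by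
      have e1 : ∀ x, 𝓕⁻ Φ x * gauss V (b n) x = ((‖𝓕⁻ Φ x * gauss V (b n) x‖ : ℝ) : ℂ) :=
        fun x => (Complex.norm_of_nonneg' (hnn x)).symm
      conv_rhs => rw [integral_congr_ae (Eventually.of_forall e1), integral_complex_ofReal]
      rw [Complex.norm_real, Real.norm_of_nonneg (integral_nonneg fun x => norm_nonneg _)]
    rw [← ofReal_integral_norm_eq_lintegral_enorm hint, e, integral_fourierInv_mul_gauss hΦ (hb0 n),
      ENNReal.ofReal_le_one]
    refine (norm_integral_le_integral_norm _).trans ?_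
    rw [← integral_norm_fourier_gauss (V := V) (hb0 n)]
    refine integral_mono_of_nonneg (Eventually.of_forall fun _ => norm_nonneg _)
      (integrable_fourier_gauss (hb0 n)).norm (Eventually.of_forall fun ξ => ?_)
    dsimp only
    rw [norm_mul]
    exact mul_le_of_le_one_left (norm_nonneg _) (hb ξ)
  -- Fatou's lemma as the Gaussians increase to 1.
  calc ∫⁻ x, ‖𝓕⁻ Φ x‖ₑ = ∫⁻ x, liminf (fun n => ‖𝓕⁻ Φ x * gauss V (b n) x‖ₑ) atTop :=
        lintegral_congr fun x => (hlim x).liminf_eq.symm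
    _ ≤ liminf (fun n => ∫⁻ x, ‖𝓕⁻ Φ x * gauss V (b n) x‖ₑ) atTop :=
        lintegral_liminf_le fun n =>
          ((continuous_fourierInv hΦ).mul (continuous_gauss _)).enorm.measurable
    _ ≤ 1 := liminf_le_of_le (by isBoundedDefault) fun c hc => by
        obtain ⟨n, hn⟩ := hc.exists
        exact hn.trans (hle n)
    _ < ⊤ := ENNReal.one_lt_top

end Gauss

/-! ### The kernel is a probability density -/

/-- A probability density, as a complex-valued function. -/
structure IsDensity {E : Type*} [MeasureSpace E] (k : E → ℂ) : Prop where
  measurable : Measurable k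
  integrable : Integrable k
  nonneg : ∀ x, 0 ≤ k x
  integral_eq_one : ∫ x, k x = 1

section Kernel

variable {d : ℕ} {α β lam t : ℝ}

/-- The dilation absorbs two normalisations: the frequency is 2π‖η‖, and the criterion evaluates the
profile at half the norm. Hence c = 4π in the application. -/
theorem isAskeyProfile_decay (hα : 0 ≤ α) (hβ₀ : 0 < β) (hβ₁ : β ≤ 1)
    (hlam : Real.exp ((3 + 2 * α) / β) ≤ lam) (ht : 0 < t) {c : ℝ} (hc : 0 < c) :
    IsAskeyProfile (fun u => decay α β lam t (c * u)) (fun u => c * decayDeriv α β lam t (c * u))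
      (fun u => c ^ 2 * decayDeriv₂ α β lam t (c * u)) := by
  have h1 := one_lt_of_exp_le hα hβ₀ hlam
  have hl : ∀ r : ℝ, HasDerivAt (fun u : ℝ => c * u) c r := fun r => by
    simpa using (hasDerivAt_id r).const_mul c
  have hta : Tendsto (fun u : ℝ => c * u) atTop atTop := tendsto_id.const_mul_atTop hc
  refine ⟨fun r hr => ?_, fun r hr => ?_, fun r hr => ?_, fun r hr => ?_, ?_, ?_, ?_⟩
  · refine ((hasDerivAt_decay h1 (mul_pos hc hr)).comp r (hl r)).congr_deriv ?_
    ring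
  · refine (((hasDerivAt_decayDeriv h1 (mul_pos hc hr)).comp r (hl r)).const_mul c).congr_deriv ?_
    ring
  · have := profileDeriv_nonneg hα hβ₀ hlam (mul_pos hc hr)
    have h2 : 0 ≤ decay α β lam t (c * r) := (Real.exp_pos _).le
    have : 0 ≤ c * (t * profileDeriv α β lam (c * r) * decay α β lam t (c * r)) := by positivity
    rw [decayDeriv]
    linarith
  · have := decayDeriv₂_nonneg hα hβ₀ hβ₁ hlam ht (mul_pos hc hr)
    positivity
  · intro r hr s hs hrs
    have hr0 : 0 < r := hr
    have hs0 : 0 < s := hs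
    have := decayDeriv₂_div_antitoneOn hα hβ₀ hβ₁ hlam ht (Set.mem_Ioi.2 (mul_pos hc hr0))
      (Set.mem_Ioi.2 (mul_pos hc hs0)) (mul_le_mul_of_nonneg_left hrs hc.le)
    have e : ∀ x, c ^ 2 * decayDeriv₂ α β lam t (c * x) / x =
        c ^ 3 * (decayDeriv₂ α β lam t (c * x) / (c * x)) := by
      intro x
      field_simp
    dsimp only at this ⊢
    rw [e, e]
    gcongr
  · exact (decay_tendsto_zero hβ₀ h1 ht).comp hta
  · simpa using ((decayDeriv_tendsto_zero hα hβ₀ hβ₁ hlam ht).comp hta).const_mul c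

theorem kernel_nonneg (hd₀ : d ≠ 0) (hd₃ : d ≤ 3) (hα : 0 ≤ α) (hβ₀ : 0 < β) (hβ₁ : β ≤ 1)
    (hlam : Real.exp ((3 + 2 * α) / β) ≤ lam) (ht : 0 < t) (x : EuclideanSpace ℝ (Fin d)) :
    0 ≤ kernel d α β lam t x := by
  have h1 := one_lt_of_exp_le hα hβ₀ hlam
  have : Nontrivial (EuclideanSpace ℝ (Fin d)) := by
    refine Module.nontrivial_of_finrank_pos (R := ℝ) ?_
    rw [finrank_euclideanSpace_fin]
    exact Nat.pos_of_ne_zero hd₀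
  have e : ∀ η : EuclideanSpace ℝ (Fin d), kernelHat α β lam t η =
      (decay α β lam t (4 * Real.pi * (‖η‖ / 2)) : ℂ) := by
    intro η
    rw [kernelHat_eq_decay]
    congr 2
    ring
  have hi := integrable_kernelHat (d := d) (α := α) hβ₀ h1 ht
  rw [funext e] at hi
  rw [kernel, funext e]
  refine (isAskeyProfile_decay hα hβ₀ hβ₁ hlam ht (c := 4 * Real.pi)
    (by positivity)).fourierInv_nonneg ?_ (fun r _ => (Real.exp_pos _).le) ?_ x
  · rwa [finrank_euclideanSpace_fin]
  · exact hi.re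

theorem integrable_kernel (hd₀ : d ≠ 0) (hd₃ : d ≤ 3) (hα : 0 ≤ α) (hβ₀ : 0 < β) (hβ₁ : β ≤ 1)
    (hlam : Real.exp ((3 + 2 * α) / β) ≤ lam) (ht : 0 < t) :
    Integrable (kernel d α β lam t) := by
  have h1 := one_lt_of_exp_le hα hβ₀ hlam
  exact integrable_fourierInv_of_nonneg (integrable_kernelHat hβ₀ h1 ht)
    (norm_kernelHat_le_one h1 ht.le) (kernel_nonneg hd₀ hd₃ hα hβ₀ hβ₁ hlam ht)

/-- Inversion requires the forward transform of `kernelHat` to be integrable. That transform is the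
reflected kernel, so positivity enters here through `integrable_kernel`. -/
theorem fourier_kernel (hd₀ : d ≠ 0) (hd₃ : d ≤ 3) (hα : 0 ≤ α) (hβ₀ : 0 < β) (hβ₁ : β ≤ 1)
    (hlam : Real.exp ((3 + 2 * α) / β) ≤ lam) (ht : 0 < t) :
    𝓕 (kernel d α β lam t) = kernelHat α β lam t := by
  have h1 := one_lt_of_exp_le hα hβ₀ hlam
  refine Continuous.fourier_fourierInv_eq (continuous_kernelHat hβ₀ h1)
    (integrable_kernelHat hβ₀ h1 ht) ?_
  have e : 𝓕 (kernelHat α β lam t : EuclideanSpace ℝ (Fin d) → ℂ) =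
      fun x => kernel d α β lam t (-x) := by
    funext x
    rw [kernel, Real.fourierInv_eq_fourier_neg, neg_neg]
  rw [e]
  exact (integrable_kernel hd₀ hd₃ hα hβ₀ hβ₁ hlam ht).comp_neg

theorem kernelHat_zero (hβ₀ : 0 < β) :
    kernelHat α β lam t (0 : EuclideanSpace ℝ (Fin d)) = 1 := by
  simp [kernelHat, symbol, Real.zero_rpow hβ₀.ne']

theorem isDensity_kernel (hd₀ : d ≠ 0) (hd₃ : d ≤ 3) (hα : 0 ≤ α) (hβ₀ : 0 < β) (hβ₁ : β ≤ 1)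
    (hlam : Real.exp ((3 + 2 * α) / β) ≤ lam) (ht : 0 < t) :
    IsDensity (kernel d α β lam t) where
  measurable := (continuous_fourierInv
    (integrable_kernelHat hβ₀ (one_lt_of_exp_le hα hβ₀ hlam) ht)).measurable
  integrable := integrable_kernel hd₀ hd₃ hα hβ₀ hβ₁ hlam ht
  nonneg := kernel_nonneg hd₀ hd₃ hα hβ₀ hβ₁ hlam ht
  integral_eq_one := by
    have h := congrFun (fourier_kernel hd₀ hd₃ hα hβ₀ hβ₁ hlam ht) 0
    rw [kernelHat_zero hβ₀] at h
    simpa [Real.fourier_eq] using h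

theorem kernelHat_mul_kernelHat {s : ℝ} (η : EuclideanSpace ℝ (Fin d)) :
    kernelHat α β lam s η * kernelHat α β lam t η = kernelHat α β lam (s + t) η := by
  simp only [kernelHat]
  rw [← Complex.ofReal_mul, ← Real.exp_add]
  congr 2
  ring

/-- The convolution is continuous and integrable with integrable transform exp(-(s+t)m), so Fourier
inversion gives equality at every point and not merely almost everywhere. -/
theorem kernel_convolution_kernel (hd₀ : d ≠ 0) (hd₃ : d ≤ 3) (hα : 0 ≤ α) (hβ₀ : 0 < β)
    (hβ₁ : β ≤ 1) (hlam : Real.exp ((3 + 2 * α) / β) ≤ lam) {s : ℝ} (hs : 0 < s) (ht : 0 < t) :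
    kernel d α β lam s ⋆[ContinuousLinearMap.mul ℂ ℂ, volume] kernel d α β lam t =
      kernel d α β lam (s + t) := by
  have h1 := one_lt_of_exp_le hα hβ₀ hlam
  have is := integrable_kernel hd₀ hd₃ hα hβ₀ hβ₁ hlam hs
  have it := integrable_kernel hd₀ hd₃ hα hβ₀ hβ₁ hlam ht
  have hF : 𝓕 (kernel d α β lam s ⋆[ContinuousLinearMap.mul ℂ ℂ, volume] kernel d α β lam t) =
      kernelHat α β lam (s + t) := by
    funext η
    rw [Real.fourier_mul_convolution_eq is it, fourier_kernel hd₀ hd₃ hα hβ₀ hβ₁ hlam hs,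
      fourier_kernel hd₀ hd₃ hα hβ₀ hβ₁ hlam ht, kernelHat_mul_kernelHat]
  have hc : Continuous
      (kernel d α β lam s ⋆[ContinuousLinearMap.mul ℂ ℂ, volume] kernel d α β lam t) := by
    refine BddAbove.continuous_convolution_right_of_integrable _ ?_ is
      (continuous_fourierInv (integrable_kernelHat hβ₀ h1 ht))
    exact ⟨_, Set.forall_mem_range.2 fun x => norm_fourierInv_le _ x⟩
  have h := Continuous.fourierInv_fourier_eq hc (is.integrable_convolution _ it) (by
    rw [hF]
    exact integrable_kernelHat hβ₀ h1 (add_pos hs ht))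
  rw [← h, hF, kernel]

/-- The kernels concentrate at the origin as `t → 0`. -/
theorem tendsto_integral_kernel_mul_gauss (hβ₀ : 0 < β) (hlam : 1 < lam) {b : ℝ} (hb : 0 < b) :
    Tendsto (fun t : ℝ => ∫ x, kernel d α β lam t x * gauss (EuclideanSpace ℝ (Fin d)) b x)
      (𝓝[>] 0) (𝓝 1) := by
  rw [← integral_fourier_gauss (V := EuclideanSpace ℝ (Fin d)) hb]
  -- On the Fourier side the integrand tends to the transform of the Gaussian because exp(-t m) → 1,
  -- and that transform dominates it.
  have h : Tendsto (fun t : ℝ => ∫ ξ, kernelHat α β lam t ξ *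
      𝓕 (gauss (EuclideanSpace ℝ (Fin d)) b) ξ) (𝓝[>] 0)
      (𝓝 (∫ ξ, 𝓕 (gauss (EuclideanSpace ℝ (Fin d)) b) ξ)) := by
    refine tendsto_integral_filter_of_dominated_convergence
      (fun ξ => ‖𝓕 (gauss (EuclideanSpace ℝ (Fin d)) b) ξ‖) ?_ ?_
      (integrable_fourier_gauss hb).norm ?_
    · exact Eventually.of_forall fun t =>
        (continuous_kernelHat hβ₀ hlam).aestronglyMeasurable.mul
          (integrable_fourier_gauss hb).aestronglyMeasurable
    · filter_upwards [self_mem_nhdsWithin] with t ht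
      refine Eventually.of_forall fun ξ => ?_
      rw [norm_mul]
      exact mul_le_of_le_one_left (norm_nonneg _) (norm_kernelHat_le_one hlam (le_of_lt ht) ξ)
    · refine Eventually.of_forall fun ξ => ?_
      have hc : Continuous fun t : ℝ => kernelHat α β lam t ξ *
          𝓕 (gauss (EuclideanSpace ℝ (Fin d)) b) ξ := by
        unfold kernelHat
        fun_prop
      have := (hc.tendsto 0).mono_left (nhdsWithin_le_nhds (s := Set.Ioi 0))
      simpa [kernelHat] using this
  refine h.congr' ?_
  filter_upwards [self_mem_nhdsWithin] with t ht
  exact (integral_fourierInv_mul_gauss (integrable_kernelHat hβ₀ hlam ht) hb).symm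

end Kernel

/-! ### Convolution with a probability density on `L^p` -/

section Density

variable {V : Type*} [NormedAddCommGroup V] [InnerProductSpace ℝ V] [MeasurableSpace V]
  [BorelSpace V] [FiniteDimensional ℝ V] {k : V → ℂ}

theorem IsDensity.lintegral_enorm (hk : IsDensity k) : ∫⁻ y, ‖k y‖ₑ = 1 := by
  rw [← ofReal_integral_norm_eq_lintegral_enorm hk.integrable, ENNReal.ofReal_eq_one]
  have h := hk.integral_eq_one
  have e : ∀ y, k y = ((‖k y‖ : ℝ) : ℂ) := fun y => (Complex.norm_of_nonneg' (hk.nonneg y)).symm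
  rw [integral_congr_ae (Eventually.of_forall e), integral_complex_ofReal] at h
  exact_mod_cast h

/-- Jensen's inequality for the average against a density. -/
theorem IsDensity.rpow_lintegral_le (hk : IsDensity k) {g : V → ℝ≥0∞} (hg : Measurable g) {r : ℝ}
    (hr : 1 ≤ r) : (∫⁻ y, ‖k y‖ₑ * g y) ^ r ≤ ∫⁻ y, ‖k y‖ₑ * g y ^ r := by
  let ν : Measure V := volume.withDensity fun y => ‖k y‖ₑ
  have : IsProbabilityMeasure ν :=
    ⟨by rw [withDensity_apply _ MeasurableSet.univ, setLIntegral_univ, hk.lintegral_enorm]⟩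
  have h := eLpNorm'_le_eLpNorm'_of_exponent_le (μ := ν) one_pos hr hg.aestronglyMeasurable
  simp only [eLpNorm'_eq_lintegral_enorm, enorm_eq_self, ENNReal.rpow_one, div_one] at h
  rw [lintegral_withDensity_eq_lintegral_mul _ hk.measurable.enorm hg,
    lintegral_withDensity_eq_lintegral_mul _ hk.measurable.enorm (hg.pow_const r),
    one_div, ENNReal.le_rpow_inv_iff (by positivity)] at h
  exact h

/-- Jensen's inequality followed by Tonelli. With G = g(x - y) it gives the L^p contraction, and
with G = ‖f(x - y) - f(x)‖ₑ the estimate behind strong continuity. -/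
theorem IsDensity.lintegral_rpow_le (hk : IsDensity k) {G : V → V → ℝ≥0∞}
    (hG : Measurable (Function.uncurry G)) {r : ℝ} (hr : 1 ≤ r) :
    ∫⁻ x, (∫⁻ y, ‖k y‖ₑ * G x y) ^ r ≤ ∫⁻ y, ‖k y‖ₑ * ∫⁻ x, G x y ^ r := by
  refine (lintegral_mono fun x =>
    hk.rpow_lintegral_le (hG.comp measurable_prodMk_left) hr).trans_eq ?_
  rw [lintegral_lintegral_swap]
  · refine lintegral_congr fun y => ?_
    exact lintegral_const_mul _ ((hG.comp measurable_prodMk_right).pow_const r)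
  · exact ((hk.measurable.comp measurable_snd).enorm.mul (hG.pow_const r)).aemeasurable

theorem IsDensity.lintegral_conv_rpow_le (hk : IsDensity k) {g : V → ℝ≥0∞} (hg : Measurable g)
    {r : ℝ} (hr : 1 ≤ r) :
    ∫⁻ x, (∫⁻ y, ‖k y‖ₑ * g (x - y)) ^ r ≤ ∫⁻ x, g x ^ r := by
  refine (hk.lintegral_rpow_le (G := fun x y => g (x - y))
    (hg.comp (measurable_fst.sub measurable_snd)) hr).trans_eq ?_
  simp_rw [lintegral_sub_right_eq_self (fun x => g x ^ r)]
  rw [lintegral_mul_const _ hk.measurable.enorm, hk.lintegral_enorm, one_mul]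

theorem IsDensity.ae_lintegral_conv_lt_top (hk : IsDensity k) {g : V → ℝ≥0∞} (hg : Measurable g)
    {r : ℝ} (hr : 1 ≤ r) (hfin : ∫⁻ x, g x ^ r ≠ ⊤) :
    ∀ᵐ x, ∫⁻ y, ‖k y‖ₑ * g (x - y) < ⊤ := by
  have hm : Measurable fun x => ∫⁻ y, ‖k y‖ₑ * g (x - y) :=
    Measurable.lintegral_prod_right' (f := fun z : V × V => ‖k z.2‖ₑ * g (z.1 - z.2))
      ((hk.measurable.comp measurable_snd).enorm.mul
        (hg.comp (measurable_fst.sub measurable_snd)))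
  have h := ae_lt_top (hm.pow_const r)
    (ne_top_of_le_ne_top hfin (hk.lintegral_conv_rpow_le hg hr))
  filter_upwards [h] with x hx
  by_contra hc
  rw [not_lt, top_le_iff] at hc
  rw [hc, ENNReal.top_rpow_of_pos (by positivity)] at hx
  exact lt_irrefl _ hx

variable {p : ℝ≥0∞} [Fact (1 ≤ p)]

theorem one_le_toReal (hp : p ≠ ⊤) : 1 ≤ p.toReal := by
  have h : 1 ≤ p := Fact.out
  rwa [← ENNReal.toReal_one, ENNReal.toReal_le_toReal ENNReal.one_ne_top hp]

theorem lintegral_rpow_enorm_ne_top (hp : p ≠ ⊤) (f : Lp ℂ p (volume : Measure V)) :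
    ∫⁻ x, ‖f x‖ₑ ^ p.toReal ≠ ⊤ :=
  (lintegral_rpow_enorm_lt_top_of_eLpNorm_lt_top (one_pos.trans_le Fact.out).ne' hp
    (Lp.eLpNorm_lt_top f)).ne

theorem IsDensity.ae_lintegral_conv_enorm_lt_top (hk : IsDensity k) (hp : p ≠ ⊤)
    (f : Lp ℂ p (volume : Measure V)) :
    ∀ᵐ x, ∫⁻ y, ‖k y‖ₑ * ‖f (x - y)‖ₑ < ⊤ :=
  hk.ae_lintegral_conv_lt_top (g := fun x => ‖f x‖ₑ)
    (Lp.stronglyMeasurable f).measurable.enorm (one_le_toReal hp)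
    (lintegral_rpow_enorm_ne_top hp f)

theorem IsDensity.convolutionExistsAt (hk : IsDensity k) {f : V → ℂ} (hf : Measurable f) {x : V}
    (hx : ∫⁻ y, ‖k y‖ₑ * ‖f (x - y)‖ₑ < ⊤) :
    ConvolutionExistsAt k f x (ContinuousLinearMap.mul ℂ ℂ) volume := by
  refine ⟨(hk.measurable.mul (hf.comp (measurable_const.sub measurable_id))).aestronglyMeasurable,
    ?_⟩
  rw [HasFiniteIntegral]
  simpa only [ContinuousLinearMap.mul_apply', enorm_mul] using hx

theorem IsDensity.ae_convolutionExistsAt (hk : IsDensity k) (hp : p ≠ ⊤)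
    (f : Lp ℂ p (volume : Measure V)) :
    ∀ᵐ x, ConvolutionExistsAt k f x (ContinuousLinearMap.mul ℂ ℂ) volume := by
  filter_upwards [hk.ae_lintegral_conv_enorm_lt_top hp f] with x hx
  exact hk.convolutionExistsAt (Lp.stronglyMeasurable f).measurable hx

theorem enorm_convolution_le (k f : V → ℂ) (x : V) :
    ‖(k ⋆[ContinuousLinearMap.mul ℂ ℂ, volume] f) x‖ₑ ≤ ∫⁻ y, ‖k y‖ₑ * ‖f (x - y)‖ₑ := by
  rw [convolution_def]
  refine (enorm_integral_le_lintegral_enorm _).trans_eq ?_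
  simp only [ContinuousLinearMap.mul_apply', enorm_mul]

theorem IsDensity.stronglyMeasurable_convolution (hk : IsDensity k) {f : V → ℂ}
    (hf : Measurable f) :
    StronglyMeasurable (k ⋆[ContinuousLinearMap.mul ℂ ℂ, volume] f) :=
  StronglyMeasurable.integral_prod_right' (f := fun z : V × V => k z.2 * f (z.1 - z.2))
    ((hk.measurable.comp measurable_snd).mul
      (hf.comp (measurable_fst.sub measurable_snd))).stronglyMeasurable

theorem IsDensity.eLpNorm_convolution_le (hk : IsDensity k) (hp : p ≠ ⊤) {f : V → ℂ}
    (hf : Measurable f) :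
    eLpNorm (k ⋆[ContinuousLinearMap.mul ℂ ℂ, volume] f) p volume ≤ eLpNorm f p volume := by
  have hp0 : p ≠ 0 := (one_pos.trans_le Fact.out).ne'
  have hr := one_le_toReal hp
  rw [eLpNorm_eq_lintegral_rpow_enorm_toReal hp0 hp, eLpNorm_eq_lintegral_rpow_enorm_toReal hp0 hp]
  refine ENNReal.rpow_le_rpow ?_ (by positivity)
  refine (lintegral_mono fun x => ?_).trans
    (hk.lintegral_conv_rpow_le (g := fun x => ‖f x‖ₑ) hf.enorm hr)
  exact ENNReal.rpow_le_rpow (enorm_convolution_le k f x) (by positivity)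

theorem IsDensity.memLp_convolution (hk : IsDensity k) (hp : p ≠ ⊤)
    (f : Lp ℂ p (volume : Measure V)) :
    MemLp (k ⋆[ContinuousLinearMap.mul ℂ ℂ, volume] f) p volume :=
  ⟨(hk.stronglyMeasurable_convolution
    (Lp.stronglyMeasurable f).measurable).aestronglyMeasurable,
    (hk.eLpNorm_convolution_le hp (Lp.stronglyMeasurable f).measurable).trans_lt
      (Lp.eLpNorm_lt_top f)⟩

/-- Convolution with a probability density, as an operator on `L^p`. -/
def convLp (hk : IsDensity k) (hp : p ≠ ⊤) :
    Lp ℂ p (volume : Measure V) →L[ℂ] Lp ℂ p (volume : Measure V) :=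
  LinearMap.mkContinuous
    { toFun := fun f => (hk.memLp_convolution hp f).toLp _
      map_add' := fun f g => by
        rw [← MemLp.toLp_add]
        refine MemLp.toLp_congr _ _ ?_
        filter_upwards [hk.ae_convolutionExistsAt hp f, hk.ae_convolutionExistsAt hp g]
          with x hf hg
        rw [convolution_congr _ (ae_eq_refl k) (Lp.coeFn_add f g), hf.distrib_add hg]
        rfl
      map_smul' := fun c f => by
        rw [RingHom.id_apply, ← MemLp.toLp_const_smul]
        refine MemLp.toLp_congr _ _ (Eventually.of_forall fun x => ?_)
        rw [convolution_congr _ (ae_eq_refl k) (Lp.coeFn_smul c f), convolution_smul] }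
    1 (fun f => by
      rw [one_mul]
      change ‖(hk.memLp_convolution hp f).toLp _‖ ≤ ‖f‖
      rw [Lp.norm_toLp, Lp.norm_def]
      exact ENNReal.toReal_mono (Lp.eLpNorm_ne_top f)
        (hk.eLpNorm_convolution_le hp (Lp.stronglyMeasurable f).measurable))

theorem coeFn_convLp (hk : IsDensity k) (hp : p ≠ ⊤) (f : Lp ℂ p (volume : Measure V)) :
    convLp hk hp f =ᵐ[volume] k ⋆[ContinuousLinearMap.mul ℂ ℂ, volume] f :=
  MemLp.coeFn_toLp (hk.memLp_convolution hp f)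

theorem norm_convLp_le_one (hk : IsDensity k) (hp : p ≠ ⊤) :
    ‖(convLp hk hp : Lp ℂ p (volume : Measure V) →L[ℂ] Lp ℂ p (volume : Measure V))‖ ≤ 1 :=
  LinearMap.mkContinuous_norm_le _ zero_le_one _

theorem convLp_nonneg (hk : IsDensity k) (hp : p ≠ ⊤) {f : Lp ℂ p (volume : Measure V)}
    (hf : ∀ᵐ x, 0 ≤ f x) : ∀ᵐ x, 0 ≤ convLp hk hp f x := by
  filter_upwards [coeFn_convLp hk hp f] with x hx
  rw [hx, convolution_def]
  refine integral_nonneg_of_ae ?_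
  filter_upwards [(quasiMeasurePreserving_sub_left_of_right_invariant volume x).ae hf] with y hy
  exact mul_nonneg (hk.nonneg y) hy

theorem complex_enorm_le_one_iff {z : ℂ} : ‖z‖ₑ ≤ 1 ↔ ‖z‖ ≤ 1 := by
  rw [← ofReal_norm, ENNReal.ofReal_le_one]

theorem convLp_norm_le (hk : IsDensity k) (hp : p ≠ ⊤) {f : Lp ℂ p (volume : Measure V)}
    (hf : ∀ᵐ x, ‖f x‖ ≤ 1) : ∀ᵐ x, ‖convLp hk hp f x‖ ≤ 1 := by
  filter_upwards [coeFn_convLp hk hp f] with x hx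
  rw [hx, ← complex_enorm_le_one_iff]
  refine (enorm_convolution_le k f x).trans ?_
  rw [← hk.lintegral_enorm]
  refine lintegral_mono_ae ?_
  filter_upwards [(quasiMeasurePreserving_sub_left_of_right_invariant volume x).ae hf] with y hy
  exact mul_le_of_le_one_right' (complex_enorm_le_one_iff.2 hy)

/-- This is associativity of convolution, which at a point x needs absolute convergence of the
double integral. It holds for almost every x because |k₂| ⋆ |f| lies in L^p, so convolving it with
|k₁| is finite almost everywhere. -/
theorem convLp_comp (hp : p ≠ ⊤) {k₁ k₂ k₃ : V → ℂ} (h₁ : IsDensity k₁) (h₂ : IsDensity k₂)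
    (h₃ : IsDensity k₃) (h : k₁ ⋆[ContinuousLinearMap.mul ℂ ℂ, volume] k₂ = k₃) :
    (convLp h₃ hp : Lp ℂ p (volume : Measure V) →L[ℂ] Lp ℂ p (volume : Measure V)) =
      (convLp h₁ hp).comp (convLp h₂ hp) := by
  ext1 f
  apply Lp.ext
  have hfm : Measurable f := (Lp.stronglyMeasurable f).measurable
  have hr := one_le_toReal hp
  have hN := h₂.ae_lintegral_conv_enorm_lt_top hp f
  set g : V → ℝ≥0∞ := fun x => ∫⁻ y, ‖k₂ y‖ₑ * ‖f (x - y)‖ₑ with hg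
  have hgm : Measurable g :=
    Measurable.lintegral_prod_right' (f := fun z : V × V => ‖k₂ z.2‖ₑ * ‖f (z.1 - z.2)‖ₑ)
      ((h₂.measurable.comp measurable_snd).enorm.mul
        (hfm.comp (measurable_fst.sub measurable_snd)).enorm)
  have hg1 := h₁.ae_lintegral_conv_lt_top hgm hr (ne_top_of_le_ne_top
    (lintegral_rpow_enorm_ne_top hp f)
    (h₂.lintegral_conv_rpow_le (g := fun x => ‖f x‖ₑ) hfm.enorm hr))
  have hex : ∀ᵐ x, ConvolutionExistsAt (fun x => ‖k₂ x‖) (fun x => ‖f x‖) x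
      (ContinuousLinearMap.mul ℝ ℝ) volume := by
    filter_upwards [hN] with x hx
    refine ⟨(h₂.measurable.norm.mul
      (hfm.comp (measurable_const.sub measurable_id)).norm).aestronglyMeasurable, ?_⟩
    rw [HasFiniteIntegral]
    simpa only [ContinuousLinearMap.mul_apply', enorm_mul, enorm_norm] using hx
  have hcm : Measurable ((fun x => ‖k₂ x‖) ⋆[ContinuousLinearMap.mul ℝ ℝ, volume]
      fun x => ‖f x‖) :=
    (StronglyMeasurable.integral_prod_right'
      (f := fun z : V × V => ‖k₂ z.2‖ * ‖f (z.1 - z.2)‖)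
      ((h₂.measurable.comp measurable_snd).norm.mul
        (hfm.comp (measurable_fst.sub measurable_snd)).norm).stronglyMeasurable).measurable
  filter_upwards [hg1, coeFn_convLp h₃ hp f, coeFn_convLp h₁ hp (convLp h₂ hp f)] with x hx e₃ e₁
  rw [ContinuousLinearMap.comp_apply, e₃, e₁,
    convolution_congr _ (ae_eq_refl k₁) (coeFn_convLp h₂ hp f), ← h]
  refine convolution_assoc _ _ _ _ (fun a b c => mul_assoc a b c)
    h₁.integrable.aestronglyMeasurable h₂.integrable.aestronglyMeasurable
    (Lp.aestronglyMeasurable f) (h₁.integrable.ae_convolution_exists _ h₂.integrable) hex ?_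
  refine ⟨(h₁.measurable.norm.mul
    (hcm.comp (measurable_const.sub measurable_id))).aestronglyMeasurable, ?_⟩
  rw [HasFiniteIntegral]
  refine lt_of_le_of_lt (lintegral_mono fun y => ?_) hx
  rw [ContinuousLinearMap.mul_apply', enorm_mul, enorm_norm]
  gcongr
  rw [convolution_def]
  refine (enorm_integral_le_lintegral_enorm _).trans_eq ?_
  simp only [ContinuousLinearMap.mul_apply', enorm_mul, enorm_norm, hg]

/-- The pointwise modulus of a convolution is at most the convolution of the modulus. -/
theorem norm_convolution_le (hk : IsDensity k) (f : V → ℂ) (x : V) :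
    ((‖(k ⋆[ContinuousLinearMap.mul ℂ ℂ, volume] f) x‖ : ℝ) : ℂ) ≤
      (k ⋆[ContinuousLinearMap.mul ℂ ℂ, volume] fun y => ((‖f y‖ : ℝ) : ℂ)) x := by
  rw [convolution_def, convolution_def]
  have e : ∀ y, (ContinuousLinearMap.mul ℂ ℂ (k y)) ((‖f (x - y)‖ : ℝ) : ℂ) =
      ((‖(ContinuousLinearMap.mul ℂ ℂ (k y)) (f (x - y))‖ : ℝ) : ℂ) := by
    intro y
    rw [ContinuousLinearMap.mul_apply', ContinuousLinearMap.mul_apply', norm_mul,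
      Complex.ofReal_mul, Complex.norm_of_nonneg' (hk.nonneg y)]
  simp_rw [e]
  rw [integral_complex_ofReal]
  exact_mod_cast norm_integral_le_integral_norm _

end Density

/-! ### Strong continuity -/

section StrongContinuity

variable {V : Type*} [NormedAddCommGroup V] [InnerProductSpace ℝ V] [MeasurableSpace V]
  [BorelSpace V] [FiniteDimensional ℝ V] {k : V → ℂ} {p : ℝ≥0∞} [Fact (1 ≤ p)]

/-- The `p`-th power of the modulus of continuity of translations. -/
def translationModulus (p : ℝ≥0∞) (f : Lp ℂ p (volume : Measure V)) (y : V) : ℝ≥0∞ :=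
  ∫⁻ x, ‖f (x - y) - f x‖ₑ ^ p.toReal

/-- Since k has mass one, (k ⋆ f)(x) - f(x) is the k-average of f(x - y) - f(x), to which Jensen's
inequality applies. -/
theorem IsDensity.enorm_convLp_sub_rpow_le (hk : IsDensity k) (hp : p ≠ ⊤)
    (f : Lp ℂ p (volume : Measure V)) :
    ‖convLp hk hp f - f‖ₑ ^ p.toReal ≤ ∫⁻ y, ‖k y‖ₑ * translationModulus p f y := by
  have hp0 : p ≠ 0 := (one_pos.trans_le Fact.out).ne'
  have hr := one_le_toReal hp
  have hfm : Measurable f := (Lp.stronglyMeasurable f).measurable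
  refine le_trans ?_ (hk.lintegral_rpow_le (G := fun x y => ‖f (x - y) - f x‖ₑ)
    ((hfm.comp (measurable_fst.sub measurable_snd)).sub (hfm.comp measurable_fst)).enorm hr)
  rw [Lp.enorm_def, eLpNorm_eq_lintegral_rpow_enorm_toReal hp0 hp, ← ENNReal.rpow_mul,
    one_div_mul_cancel (by positivity), ENNReal.rpow_one]
  refine lintegral_mono_ae ?_
  filter_upwards [Lp.coeFn_sub (convLp hk hp f) f, coeFn_convLp hk hp f,
    hk.ae_convolutionExistsAt hp f] with x h₁ h₂ h₃
  refine ENNReal.rpow_le_rpow ?_ (by positivity)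
  rw [h₁, Pi.sub_apply, h₂, convolution_def]
  have e : f x = ∫ y, k y * f x := by
    rw [integral_mul_const, hk.integral_eq_one, one_mul]
  have h₃' : Integrable fun y => k y * f (x - y) := h₃
  conv_lhs => rw [e]
  simp only [ContinuousLinearMap.mul_apply']
  rw [← integral_sub h₃' (hk.integrable.mul_const _)]
  refine (enorm_integral_le_lintegral_enorm _).trans_eq ?_
  simp only [← mul_sub, enorm_mul]

/-- Translations form a continuous family of measure-preserving maps, and composition with such a
family is continuous in L^p for finite p. -/
theorem tendsto_translationModulus (hp : p ≠ ⊤) (f : Lp ℂ p (volume : Measure V)) :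
    Tendsto (translationModulus p f) (𝓝 0) (𝓝 0) := by
  have hp0 : p ≠ 0 := (one_pos.trans_le Fact.out).ne'
  have hr := one_le_toReal hp
  let g : C(V, C(V, V)) := ContinuousMap.curry ⟨fun z : V × V => z.2 - z.1, by fun_prop⟩
  have hgm : ∀ y, MeasurePreserving (g y) volume volume := fun y =>
    measurePreserving_sub_right volume y
  have hc : Continuous fun y => Lp.compMeasurePreserving (g y) (hgm y) f :=
    continuous_const.compMeasurePreservingLp g.continuous hgm hp
  have e : ∀ y, translationModulus p f y =
      ‖Lp.compMeasurePreserving (g y) (hgm y) f - f‖ₑ ^ p.toReal := by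
    intro y
    rw [Lp.enorm_def, eLpNorm_eq_lintegral_rpow_enorm_toReal hp0 hp, ← ENNReal.rpow_mul,
      one_div_mul_cancel (by positivity), ENNReal.rpow_one, translationModulus]
    refine lintegral_congr_ae ?_
    filter_upwards [Lp.coeFn_sub (Lp.compMeasurePreserving (g y) (hgm y) f) f,
      Lp.coeFn_compMeasurePreserving f (hgm y)] with x h₁ h₂
    rw [h₁, Pi.sub_apply, h₂]
    rfl
  have h0 : translationModulus p f 0 = 0 := by
    simp [translationModulus, ENNReal.zero_rpow_of_pos (one_pos.trans_le hr)]
  rw [← h0, funext e]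
  exact ((ENNReal.continuous_rpow_const).comp (hc.sub continuous_const).enorm).tendsto 0

theorem translationModulus_le (hp : p ≠ ⊤) (f : Lp ℂ p (volume : Measure V)) :
    ∃ M : ℝ≥0, ∀ y, translationModulus p f y ≤ M := by
  have hr := one_le_toReal hp
  have hfm : Measurable f := (Lp.stronglyMeasurable f).measurable
  set N := ∫⁻ x, ‖f x‖ₑ ^ p.toReal with hN
  have hfin : N ≠ ⊤ := lintegral_rpow_enorm_ne_top hp f
  have hM : 2 ^ (p.toReal - 1) * (N + N) ≠ ⊤ := by finiteness
  refine ⟨(2 ^ (p.toReal - 1) * (N + N)).toNNReal, fun y => ?_⟩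
  rw [ENNReal.coe_toNNReal hM]
  calc translationModulus p f y
      ≤ ∫⁻ x, 2 ^ (p.toReal - 1) * (‖f (x - y)‖ₑ ^ p.toReal + ‖f x‖ₑ ^ p.toReal) := by
        refine lintegral_mono fun x => ?_
        refine (ENNReal.rpow_le_rpow enorm_sub_le (by positivity)).trans ?_
        exact ENNReal.rpow_add_le_mul_rpow_add_rpow _ _ hr
    _ = 2 ^ (p.toReal - 1) * (N + N) := by
        rw [lintegral_const_mul _ (by fun_prop), lintegral_add_left (by fun_prop),
          lintegral_sub_right_eq_self (fun x => ‖f x‖ₑ ^ p.toReal)]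

/-- If the densities `k i` concentrate at the origin then the convolutions with them converge
strongly to the identity. -/
theorem tendsto_norm_convLp_sub {ι : Type*} {l : Filter ι} (hp : p ≠ ⊤) {k : ι → V → ℂ}
    (hk : ∀ i, IsDensity (k i))
    (hl : Tendsto (fun i => ∫ x, k i x * gauss V 1 x) l (𝓝 1))
    (f : Lp ℂ p (volume : Measure V)) :
    Tendsto (fun i => ‖convLp (hk i) hp f - f‖) l (𝓝 0) := by
  have hr := one_le_toReal hp
  obtain ⟨M, hM⟩ := translationModulus_le hp f
  -- The deficit in the Gaussian test measures the mass of k away from the origin, and `hl` says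
  -- that it tends to zero.
  have hdef : ∀ i, ∫⁻ y, ‖k i y‖ₑ * ENNReal.ofReal (1 - Real.exp (-1 * ‖y‖ ^ 2)) =
      ENNReal.ofReal (1 - (∫ x, k i x * gauss V 1 x).re) := by
    intro i
    have hig : Integrable fun x => k i x * gauss V 1 x := by
      refine (hk i).integrable.mul_bdd (c := 1)
        (continuous_gauss 1).aestronglyMeasurable (Eventually.of_forall fun x => ?_)
      rw [norm_gauss, Real.exp_le_one_iff]
      nlinarith [sq_nonneg ‖x‖]
    have e : ∀ y, ‖k i y‖ₑ * ENNReal.ofReal (1 - Real.exp (-1 * ‖y‖ ^ 2)) =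
        ENNReal.ofReal (k i y - k i y * gauss V 1 y).re := by
      intro y
      have hn := (Complex.norm_of_nonneg' ((hk i).nonneg y)).symm
      rw [← ofReal_norm, ← ENNReal.ofReal_mul (norm_nonneg _), gauss_eq_ofReal]
      conv_rhs => rw [hn]
      congr 1
      rw [← Complex.ofReal_mul, ← Complex.ofReal_sub, Complex.ofReal_re]
      ring
    simp_rw [e]
    have hsub := (hk i).integrable.sub hig
    rw [← ofReal_integral_eq_lintegral_ofReal (f := fun y => (k i y - k i y * gauss V 1 y).re)
      hsub.re]
    · congr 1
      have := integral_re hsub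
      simp only [RCLike.re_to_complex, Pi.sub_apply] at this
      rw [this, integral_sub (hk i).integrable hig, (hk i).integral_eq_one, Complex.sub_re,
        Complex.one_re]
    · refine Eventually.of_forall fun y => ?_
      have hn := (Complex.norm_of_nonneg' ((hk i).nonneg y)).symm
      have h1 : Real.exp (-1 * ‖y‖ ^ 2) ≤ 1 :=
        Real.exp_le_one_iff.2 (by nlinarith [sq_nonneg ‖y‖])
      dsimp only [Pi.zero_apply]
      rw [gauss_eq_ofReal, hn, ← Complex.ofReal_mul, ← Complex.ofReal_sub, Complex.ofReal_re]
      nlinarith [norm_nonneg (k i y)]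
  have hlim : Tendsto (fun i => ENNReal.ofReal (1 - (∫ x, k i x * gauss V 1 x).re)) l (𝓝 0) := by
    have h1 := ENNReal.tendsto_ofReal
      ((Complex.continuous_re.continuousAt.tendsto.comp hl).const_sub 1)
    simpa using h1
  have key : Tendsto (fun i => ∫⁻ y, ‖k i y‖ₑ * translationModulus p f y) l (𝓝 0) := by
    rw [ENNReal.tendsto_nhds_zero]
    intro ε hε
    have hε2 : 0 < ε / 2 := ENNReal.half_pos hε.ne'
    obtain ⟨δ, hδ, hδ'⟩ := Metric.eventually_nhds_iff.1
      ((ENNReal.tendsto_nhds_zero.1 (tendsto_translationModulus hp f)) (ε / 2) hε2)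
    set c : ℝ := 1 - Real.exp (-1 * δ ^ 2) with hc
    have hc0 : 0 < c := by
      have : Real.exp (-1 * δ ^ 2) < 1  :=
        (Real.exp_lt_exp.2 (show -1 * δ ^ 2 < 0 by nlinarith)).trans_eq Real.exp_zero
      linarith
    -- Inside the δ-ball the modulus is small. Outside it, 1 - exp(-‖y‖²) ≥ c, so the global bound M
    -- is at most M/c times this weight, whose k-integral is the deficit.
    have hle : ∀ y, translationModulus p f y ≤
        ε / 2 + (M : ℝ≥0∞) / ENNReal.ofReal c *
          ENNReal.ofReal (1 - Real.exp (-1 * ‖y‖ ^ 2)) := by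
      intro y
      by_cases hy : ‖y‖ < δ
      · exact (hδ' (by simpa using hy)).trans le_self_add
      · refine (hM y).trans (le_trans ?_ le_add_self)
        have h1 : ENNReal.ofReal c ≤ ENNReal.ofReal (1 - Real.exp (-1 * ‖y‖ ^ 2)) := by
          refine ENNReal.ofReal_le_ofReal ?_
          have : Real.exp (-1 * ‖y‖ ^ 2) ≤ Real.exp (-1 * δ ^ 2) := by
            rw [Real.exp_le_exp]
            nlinarith
          linarith
        refine le_trans ?_ (mul_le_mul_right h1 _)
        rw [ENNReal.div_mul_cancel (by simpa using hc0) ENNReal.ofReal_ne_top]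
    have hlim2 : Tendsto (fun i => (M : ℝ≥0∞) / ENNReal.ofReal c *
        ENNReal.ofReal (1 - (∫ x, k i x * gauss V 1 x).re)) l (𝓝 0) := by
      have hne : (M : ℝ≥0∞) / ENNReal.ofReal c ≠ ⊤ :=
        ENNReal.div_ne_top ENNReal.coe_ne_top (by simpa using hc0)
      simpa using ENNReal.Tendsto.const_mul hlim (Or.inr hne)
    filter_upwards [(ENNReal.tendsto_nhds_zero.1 hlim2) (ε / 2) hε2] with i hi
    calc ∫⁻ y, ‖k i y‖ₑ * translationModulus p f y
        ≤ ∫⁻ y, (‖k i y‖ₑ * (ε / 2) + (M : ℝ≥0∞) / ENNReal.ofReal c *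
          (‖k i y‖ₑ * ENNReal.ofReal (1 - Real.exp (-1 * ‖y‖ ^ 2)))) := by
          refine lintegral_mono fun y => ?_
          refine (mul_le_mul_right (hle y) _).trans_eq ?_
          ring
      _ = ε / 2 + (M : ℝ≥0∞) / ENNReal.ofReal c *
          ENNReal.ofReal (1 - (∫ x, k i x * gauss V 1 x).re) := by
          have hm := (hk i).measurable.enorm
          rw [lintegral_add_left (hm.mul_const _), lintegral_mul_const _ hm,
            (hk i).lintegral_enorm, one_mul, lintegral_const_mul _ (by fun_prop), hdef]
      _ ≤ ε / 2 + ε / 2 := by gcongr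
      _ = ε := ENNReal.add_halves ε
  have h2 : Tendsto (fun i => ‖convLp (hk i) hp f - f‖ₑ ^ p.toReal) l (𝓝 0) :=
    tendsto_of_tendsto_of_tendsto_of_le_of_le tendsto_const_nhds key (fun _ => zero_le)
      fun i => (hk i).enorm_convLp_sub_rpow_le hp f
  have h3 := ((ENNReal.continuous_rpow_const (y := p.toReal⁻¹)).tendsto 0).comp h2
  have h4 : Tendsto (fun i => ‖convLp (hk i) hp f - f‖ₑ) l (𝓝 0) := by
    rw [ENNReal.zero_rpow_of_pos (by positivity)] at h3
    refine h3.congr fun i => ?_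
    rw [Function.comp_apply, ← ENNReal.rpow_mul, mul_inv_cancel₀ (by positivity), ENNReal.rpow_one]
  have h5 := (ENNReal.tendsto_toReal ENNReal.zero_ne_top).comp h4
  simpa [Function.comp_def] using h5

end StrongContinuity

/-! ### The semigroup on `L^p` -/

section Propagator

variable {d : ℕ} {α β lam : ℝ} {p : ℝ≥0∞} [Fact (1 ≤ p)]

/-- The family `(e^{-tℒ})_{t ≥ 0}` on `L^p`. -/
def propagator (hk : ∀ t : ℝ, 0 < t → IsDensity (kernel d α β lam t)) (hp : p ≠ ⊤) (t : ℝ≥0) :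
    LpSpace d p →L[ℂ] LpSpace d p :=
  if h : 0 < t then convLp (hk t h) hp else ContinuousLinearMap.id ℂ _

variable (hk : ∀ t : ℝ, 0 < t → IsDensity (kernel d α β lam t)) (hp : p ≠ ⊤)

theorem propagator_of_pos {t : ℝ≥0} (ht : 0 < t) : propagator hk hp t = convLp (hk t ht) hp :=
  dif_pos ht

theorem propagator_zero : propagator hk hp 0 = ContinuousLinearMap.id ℂ _ :=
  dif_neg (lt_irrefl _)

theorem isPropagator_propagator : IsPropagator α β lam p (propagator hk hp) := by
  refine ⟨propagator_zero hk hp, fun t ht f => ?_⟩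
  rw [propagator_of_pos hk hp ht]
  filter_upwards [(hk t ht).ae_convolutionExistsAt hp f, coeFn_convLp (hk t ht) hp f] with x h₁ h₂
  exact ⟨h₁, h₂⟩

theorem isC0ContractionSemigroup_propagator (hβ₀ : 0 < β) (hlam : 1 < lam)
    (hmul : ∀ s t : ℝ, 0 < s → 0 < t →
      kernel d α β lam s ⋆[ContinuousLinearMap.mul ℂ ℂ, volume] kernel d α β lam t =
        kernel d α β lam (s + t)) :
    IsC0ContractionSemigroup (propagator hk hp) where
  map_zero := propagator_zero hk hp
  map_add s t := by
    rcases eq_zero_or_pos s with rfl | hs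
    · rw [zero_add, propagator_zero, ContinuousLinearMap.id_comp]
    rcases eq_zero_or_pos t with rfl | ht
    · rw [add_zero, propagator_zero, ContinuousLinearMap.comp_id]
    rw [propagator_of_pos hk hp hs, propagator_of_pos hk hp ht,
      propagator_of_pos hk hp (add_pos hs ht)]
    exact convLp_comp hp _ _ _ (hmul s t hs ht)
  strongly_continuous f := by
    -- The densities exist only for t > 0, so the limit is taken along the subtype of positive
    -- times.
    rw [nhdsWithin, ← map_comap_setCoe_val, tendsto_map'_iff]
    have hl : Tendsto (fun t : Set.Ioi (0 : ℝ≥0) => ((t : ℝ≥0) : ℝ))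
        (comap (↑) (𝓝 (0 : ℝ≥0))) (𝓝[>] 0) := by
      refine tendsto_nhdsWithin_iff.2 ⟨?_, Eventually.of_forall fun t => t.2⟩
      exact (NNReal.continuous_coe.tendsto 0).comp tendsto_comap
    have h := tendsto_norm_convLp_sub hp (fun t : Set.Ioi (0 : ℝ≥0) => hk (t : ℝ≥0) t.2)
      ((tendsto_integral_kernel_mul_gauss (d := d) (α := α) hβ₀ hlam one_pos).comp hl) f
    refine h.congr fun t => ?_
    rw [Function.comp_apply, propagator_of_pos hk hp t.2]
  norm_le_one t := by
    rcases eq_zero_or_pos t with rfl | ht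
    · rw [propagator_zero]
      exact ContinuousLinearMap.norm_id_le
    · rw [propagator_of_pos hk hp ht]
      exact norm_convLp_le_one _ hp

theorem propagator_nonneg (t : ℝ≥0) {f : LpSpace d p} (hf : ∀ᵐ x, 0 ≤ f x) :
    ∀ᵐ x, 0 ≤ propagator hk hp t f x := by
  rcases eq_zero_or_pos t with rfl | ht
  · rw [propagator_zero]
    exact hf
  · rw [propagator_of_pos hk hp ht]
    exact convLp_nonneg _ hp hf

theorem propagator_norm_le (t : ℝ≥0) {f : LpSpace d p} (hf : ∀ᵐ x, ‖f x‖ ≤ 1) :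
    ∀ᵐ x, ‖propagator hk hp t f x‖ ≤ 1 := by
  rcases eq_zero_or_pos t with rfl | ht
  · rw [propagator_zero]
    exact hf
  · rw [propagator_of_pos hk hp ht]
    exact convLp_norm_le _ hp hf

end Propagator

/-! ### The Fourier transform of a convolution on `L²` -/

section L2

variable {d : ℕ}

theorem memLp_mul_of_norm_le_one {g : EuclideanSpace ℝ (Fin d) → ℂ} (hg : Measurable g)
    (hb : ∀ x, ‖g x‖ ≤ 1) (f : L2 d) : MemLp (fun x => g x * f x) 2 volume :=
  (Lp.memLp f).mono (hg.aestronglyMeasurable.mul (Lp.aestronglyMeasurable f))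
    (Eventually.of_forall fun x => by
      rw [norm_mul]
      exact mul_le_of_le_one_left (norm_nonneg _) (hb x))

/-- Multiplication by a measurable function bounded by one, as an operator on `L²`. -/
def mulL2 {g : EuclideanSpace ℝ (Fin d) → ℂ} (hg : Measurable g) (hb : ∀ x, ‖g x‖ ≤ 1) :
    L2 d →L[ℂ] L2 d :=
  LinearMap.mkContinuous
    { toFun := fun f => (memLp_mul_of_norm_le_one hg hb f).toLp _
      map_add' := fun f h => by
        rw [← MemLp.toLp_add]
        refine MemLp.toLp_congr _ _ ?_
        filter_upwards [Lp.coeFn_add f h] with x hx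
        rw [hx, Pi.add_apply, Pi.add_apply, mul_add]
      map_smul' := fun c f => by
        rw [RingHom.id_apply, ← MemLp.toLp_const_smul]
        refine MemLp.toLp_congr _ _ ?_
        filter_upwards [Lp.coeFn_smul c f] with x hx
        rw [hx, Pi.smul_apply, Pi.smul_apply, smul_eq_mul, smul_eq_mul, mul_left_comm] }
    1 (fun f => by
      rw [one_mul]
      refine Lp.norm_le_norm_of_ae_le ?_
      filter_upwards [MemLp.coeFn_toLp (memLp_mul_of_norm_le_one hg hb f)] with x hx
      change ‖(memLp_mul_of_norm_le_one hg hb f).toLp _ x‖ ≤ _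
      rw [hx, norm_mul]
      exact mul_le_of_le_one_left (norm_nonneg _) (hb x))

theorem coeFn_mulL2 {g : EuclideanSpace ℝ (Fin d) → ℂ} (hg : Measurable g) (hb : ∀ x, ‖g x‖ ≤ 1)
    (f : L2 d) : mulL2 hg hb f =ᵐ[volume] fun x => g x * f x :=
  MemLp.coeFn_toLp (memLp_mul_of_norm_le_one hg hb f)

/-- The bounded Fourier multiplier with a symbol bounded by one. -/
def boundedMultiplier {g : EuclideanSpace ℝ (Fin d) → ℂ} (hg : Measurable g)
    (hb : ∀ x, ‖g x‖ ≤ 1) : L2 d →L[ℂ] L2 d :=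
  ((Lp.fourierTransformₗᵢ (EuclideanSpace ℝ (Fin d)) ℂ).symm : L2 d →L[ℂ] L2 d).comp
    ((mulL2 hg hb).comp (Lp.fourierTransformₗᵢ (EuclideanSpace ℝ (Fin d)) ℂ : L2 d →L[ℂ] L2 d))

theorem boundedMultiplier_apply {g : EuclideanSpace ℝ (Fin d) → ℂ} (hg : Measurable g)
    (hb : ∀ x, ‖g x‖ ≤ 1) (f : L2 d) :
    boundedMultiplier hg hb f = 𝓕⁻ (mulL2 hg hb (𝓕 f : L2 d)) := rfl

theorem fourier_injective {f g : L2 d} (h : (𝓕 f : L2 d) =ᵐ[volume] (𝓕 g : L2 d)) : f = g :=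
  (Lp.fourierTransformₗᵢ (EuclideanSpace ℝ (Fin d)) ℂ).injective (Lp.ext h)

theorem fourier_boundedMultiplier {g : EuclideanSpace ℝ (Fin d) → ℂ} (hg : Measurable g)
    (hb : ∀ x, ‖g x‖ ≤ 1) (f : L2 d) :
    (𝓕 (boundedMultiplier hg hb f) : L2 d) =ᵐ[volume] fun η => g η * (𝓕 f : L2 d) η := by
  rw [boundedMultiplier_apply, FourierTransform.fourier_fourierInv_eq]
  exact coeFn_mulL2 hg hb _

/-- The `L²` Fourier transform agrees with the Fourier integral. -/
theorem fourier_toLp_eq_toLp_fourier {u : EuclideanSpace ℝ (Fin d) → ℂ} (hu : Integrable u)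
    (hu₂ : MemLp u 2 volume) (hw : MemLp (𝓕 u) 2 volume) :
    (𝓕 (hu₂.toLp u : L2 d) : L2 d) = hw.toLp (𝓕 u) := by
  have hinj : Function.Injective (Lp.toTemperedDistributionCLM ℂ
      (volume : Measure (EuclideanSpace ℝ (Fin d))) 2) :=
    LinearMap.ker_eq_bot.1 Lp.ker_toTemperedDistributionCLM_eq_bot
  -- L² embeds injectively into tempered distributions, where the Fourier transform is defined by
  -- duality. The claim becomes the multiplication formula against a Schwartz function.
  apply hinj
  rw [Lp.toTemperedDistributionCLM_apply, Lp.toTemperedDistributionCLM_apply,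
    ← Lp.fourier_toTemperedDistribution_eq]
  ext ψ
  rw [TemperedDistribution.fourier_apply, Lp.toTemperedDistribution_apply,
    Lp.toTemperedDistribution_apply]
  have e₁ : ∫ x, (𝓕 ψ) x • (hu₂.toLp u) x = ∫ x, (𝓕 ψ) x • u x := by
    refine integral_congr_ae ?_
    filter_upwards [hu₂.coeFn_toLp] with x hx
    rw [hx]
  have e₂ : ∫ x, ψ x • (hw.toLp (𝓕 u)) x = ∫ x, ψ x • 𝓕 u x := by
    refine integral_congr_ae ?_
    filter_upwards [hw.coeFn_toLp] with x hx
    rw [hx]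
  rw [e₁, e₂]
  simpa using! VectorFourier.integral_fourierIntegral_smul_eq_flip
    (L := innerₗ (EuclideanSpace ℝ (Fin d)))
    Real.continuous_fourierChar continuous_inner (SchwartzMap.integrable ψ) hu

theorem IsDensity.norm_fourier_le_one {k : EuclideanSpace ℝ (Fin d) → ℂ} (hk : IsDensity k)
    (η : EuclideanSpace ℝ (Fin d)) : ‖𝓕 k η‖ ≤ 1 := by
  rw [Real.fourier_eq]
  refine (norm_integral_le_integral_norm _).trans ?_
  simp only [Circle.norm_smul]
  rw [integral_norm_eq_lintegral_enorm hk.integrable.aestronglyMeasurable, hk.lintegral_enorm,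
    ENNReal.toReal_one]

theorem IsDensity.measurable_fourier {k : EuclideanSpace ℝ (Fin d) → ℂ} (hk : IsDensity k) :
    Measurable (𝓕 k) := by
  have h : Continuous (𝓕 k) := VectorFourier.fourierIntegral_continuous
    Real.continuous_fourierChar (L := innerₗ (EuclideanSpace ℝ (Fin d))) continuous_inner
    hk.integrable
  exact h.measurable

/-- On `L²`, convolution with a density is the Fourier multiplier given by its transform. -/
theorem convLp_eq_boundedMultiplier {k : EuclideanSpace ℝ (Fin d) → ℂ} (hk : IsDensity k) :
    (convLp hk ENNReal.ofNat_ne_top : L2 d →L[ℂ] L2 d) =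
      boundedMultiplier hk.measurable_fourier hk.norm_fourier_le_one := by
  ext1 f
  -- Both operators are bounded, so they need only be compared on Schwartz functions, for which k ⋆
  -- ψ is integrable and the classical convolution theorem applies.
  refine DenseRange.induction_on (p := fun f : L2 d =>
      convLp hk ENNReal.ofNat_ne_top f =
        boundedMultiplier hk.measurable_fourier hk.norm_fourier_le_one f)
    (SchwartzMap.denseRange_toLpCLM (p := 2) ENNReal.ofNat_ne_top) f
    (isClosed_eq (ContinuousLinearMap.continuous _) (ContinuousLinearMap.continuous _)) ?_
  intro ψ
  rw [SchwartzMap.toLpCLM_apply]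
  have hψ : (ψ.toLp 2 volume : L2 d) =ᵐ[volume] ψ := SchwartzMap.coeFn_toLp ψ 2 volume
  have hcong : k ⋆[ContinuousLinearMap.mul ℂ ℂ, volume] (ψ.toLp 2 volume : L2 d) =
      k ⋆[ContinuousLinearMap.mul ℂ ℂ, volume] ψ :=
    convolution_congr _ (ae_eq_refl k) hψ
  have hu₂ : MemLp (k ⋆[ContinuousLinearMap.mul ℂ ℂ, volume] ψ) 2 volume := by
    rw [← hcong]
    exact hk.memLp_convolution ENNReal.ofNat_ne_top _
  have hu : Integrable (k ⋆[ContinuousLinearMap.mul ℂ ℂ, volume] ψ) :=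
    hk.integrable.integrable_convolution _ ψ.integrable
  have hF : 𝓕 (k ⋆[ContinuousLinearMap.mul ℂ ℂ, volume] ψ) = fun η => 𝓕 k η * (𝓕 ψ) η := by
    funext η
    rw [Real.fourier_mul_convolution_eq hk.integrable ψ.integrable, SchwartzMap.fourier_coe]
  have hmem := memLp_mul_of_norm_le_one hk.measurable_fourier hk.norm_fourier_le_one
    ((𝓕 ψ).toLp 2 volume : L2 d)
  have hae : (fun η => 𝓕 k η * ((𝓕 ψ).toLp 2 volume : L2 d) η) =ᵐ[volume]
      𝓕 (k ⋆[ContinuousLinearMap.mul ℂ ℂ, volume] ψ) := by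
    rw [hF]
    filter_upwards [SchwartzMap.coeFn_toLp (𝓕 ψ) 2 volume] with η hη
    rw [hη]
  have hw : MemLp (𝓕 (k ⋆[ContinuousLinearMap.mul ℂ ℂ, volume] ψ)) 2 volume :=
    (memLp_congr_ae hae).1 hmem
  have h1 : convLp hk ENNReal.ofNat_ne_top (ψ.toLp 2 volume : L2 d) = hu₂.toLp _ :=
    MemLp.toLp_congr (hk.memLp_convolution (p := 2) ENNReal.ofNat_ne_top
      (ψ.toLp 2 volume : L2 d)) hu₂ (Eventually.of_forall fun x => congrFun hcong x)
  rw [h1]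
  refine fourier_injective ?_
  rw [fourier_toLp_eq_toLp_fourier hu hu₂ hw]
  have h2 := fourier_boundedMultiplier hk.measurable_fourier hk.norm_fourier_le_one
    (ψ.toLp 2 volume : L2 d)
  rw [SchwartzMap.toLp_fourier_eq] at h2
  exact (hw.coeFn_toLp.trans hae.symm).trans h2.symm

end L2

/-! ### Nonnegative self-adjoint Fourier multipliers -/

section Abstract

variable {H : Type*} [NormedAddCommGroup H] [InnerProductSpace ℂ H] [CompleteSpace H]

/-- A symmetric nonnegative operator `A` such that `1 + A` is surjective is self-adjoint. -/
theorem isNonnegSelfAdjoint_of_surjective {A : H →ₗ.[ℂ] H} (hs : A.IsFormalAdjoint A)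
    (h₀ : ∀ f : A.domain, 0 ≤ inner ℂ (f : H) (A f))
    (hr : ∀ g : H, ∃ f : A.domain, (f : H) + A f = g) : IsNonnegSelfAdjoint A := by
  -- A vector orthogonal to the domain has the form f + A f; pairing it with f gives ‖f‖² + ⟨f, A f⟩
  -- = 0, hence f = 0.
  have hd : Dense (A.domain : Set H) := by
    rw [Submodule.dense_iff_topologicalClosure_eq_top, Submodule.topologicalClosure_eq_top_iff,
      Submodule.eq_bot_iff]
    intro u hu
    obtain ⟨f, rfl⟩ := hr u
    have h1 := (Submodule.mem_orthogonal _ _).1 hu f f.2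
    rw [inner_add_right, inner_self_eq_norm_sq_to_K] at h1
    have h2 := h₀ f
    have h3 : ‖(f : H)‖ ^ 2 ≤ 0 := by
      have h4 : (((‖(f : H)‖ ^ 2 : ℝ) : ℂ)) = -inner ℂ (f : H) (A f) := by
        push_cast
        linear_combination h1
      have h5 : (((‖(f : H)‖ ^ 2 : ℝ) : ℂ)) ≤ ((0 : ℝ) : ℂ) := by
        rw [h4, Complex.ofReal_zero]
        exact neg_nonpos.2 h2
      exact_mod_cast h5
    have h6 : (f : H) = 0 := norm_eq_zero.1 (pow_eq_zero_iff two_ne_zero |>.1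
      (le_antisymm h3 (sq_nonneg _)))
    have h7 : f = 0 := Subtype.ext h6
    rw [h7, LinearPMap.map_zero]
    simp
  refine ⟨?_, h₀⟩
  rw [LinearPMap.isSelfAdjoint_def]
  have hle : A ≤ A.adjoint := hs.le_adjoint hd
  refine (LinearPMap.eq_of_le_of_domain_eq hle (le_antisymm hle.1 fun y hy => ?_)).symm
  -- Choosing x in the domain with (1 + A)x = (1 + A*)y makes y - x orthogonal to the range of 1 +
  -- A, which is the whole space; thus y = x lies in the domain.
  obtain ⟨x, hx⟩ := hr (A.adjoint ⟨y, hy⟩ + y)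
  have hadj := LinearPMap.adjoint_isFormalAdjoint hd
  obtain ⟨z, hz⟩ := hr (y - x)
  have h1 : inner ℂ (y - x) (y - x) = 0 := by
    nth_rewrite 2 [← hz]
    have e1 : inner ℂ y (A z) = inner ℂ (A.adjoint ⟨y, hy⟩) (z : H) := (hadj ⟨y, hy⟩ z).symm
    have e2 : inner ℂ (x : H) (A z) = inner ℂ (A x) (z : H) := (hs x z).symm
    have e3 : inner ℂ (x : H) (z : H) + inner ℂ (A x) (z : H) =
        inner ℂ (A.adjoint ⟨y, hy⟩) (z : H) + inner ℂ y (z : H) := by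
      rw [← inner_add_left, hx, inner_add_left]
    rw [inner_sub_left, inner_add_right, inner_add_right, e1, e2]
    linear_combination -e3
  have h2 : y = x := sub_eq_zero.1 (inner_self_eq_zero.1 h1)
  rw [h2]
  exact x.2

end Abstract

section Multiplier

variable {d : ℕ} {m : EuclideanSpace ℝ (Fin d) → ℝ}

theorem fourier_multiplier (f : (multiplier m).domain) :
    (𝓕 (multiplier m f) : L2 d) =ᵐ[volume] fun η => (m η : ℂ) * (𝓕 (f : L2 d) : L2 d) η := by
  change (𝓕 (𝓕⁻ (mulFourier m f) : L2 d) : L2 d) =ᵐ[volume] _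
  rw [FourierTransform.fourier_fourierInv_eq]
  exact coeFn_mulFourier m f

/-- The domain condition disappears: if m times the transform of f agrees with the transform of an
L² function, it is automatically square integrable. -/
theorem mem_graph_multiplier_iff {f g : L2 d} : (f, g) ∈ (multiplier m).graph ↔
    (𝓕 g : L2 d) =ᵐ[volume] fun η => (m η : ℂ) * (𝓕 f : L2 d) η := by
  rw [LinearPMap.mem_graph_iff]
  constructor
  · rintro ⟨y, hy, hg⟩
    dsimp only at hy hg
    subst hy
    rw [← hg]
    exact fourier_multiplier y
  · intro h
    have hf : f ∈ (multiplier m).domain := (memLp_congr_ae h).1 (Lp.memLp _)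
    exact ⟨⟨f, hf⟩, rfl, fourier_injective ((fourier_multiplier ⟨f, hf⟩).trans h.symm)⟩

theorem inner_eq_integral_fourier (f g : L2 d) :
    inner ℂ f g = ∫ η, inner ℂ ((𝓕 f : L2 d) η) ((𝓕 g : L2 d) η) := by
  rw [← Lp.inner_fourier_eq f g, L2.inner_def]

theorem norm_inv_one_add_le (hm : ∀ η, 0 ≤ m η) (η : EuclideanSpace ℝ (Fin d)) :
    ‖(((1 + m η)⁻¹ : ℝ) : ℂ)‖ ≤ 1 := by
  have := hm η
  rw [Complex.norm_real, Real.norm_of_nonneg (by positivity)]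
  exact inv_le_one_of_one_le₀ (by linarith)

/-- The resolvent `(1 + A)⁻¹` of the Fourier multiplier `A` with symbol `m ≥ 0`. -/
def resolvent (hmm : Measurable m) (hm : ∀ η, 0 ≤ m η) : L2 d →L[ℂ] L2 d :=
  boundedMultiplier (g := fun η => (((1 + m η)⁻¹ : ℝ) : ℂ)) (by fun_prop) (norm_inv_one_add_le hm)

theorem fourier_resolvent (hmm : Measurable m) (hm : ∀ η, 0 ≤ m η) (f : L2 d) :
    (𝓕 (resolvent hmm hm f) : L2 d) =ᵐ[volume]
      fun η => (((1 + m η)⁻¹ : ℝ) : ℂ) * (𝓕 f : L2 d) η :=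
  fourier_boundedMultiplier _ _ f

theorem resolvent_mem_graph (hmm : Measurable m) (hm : ∀ η, 0 ≤ m η) (f : L2 d) :
    (resolvent hmm hm f, f - resolvent hmm hm f) ∈ (multiplier m).graph := by
  rw [mem_graph_multiplier_iff]
  have e : (𝓕 (f - resolvent hmm hm f) : L2 d) = 𝓕 f - 𝓕 (resolvent hmm hm f) :=
    (Lp.fourierTransformₗᵢ (EuclideanSpace ℝ (Fin d)) ℂ).map_sub _ _
  rw [e]
  filter_upwards [Lp.coeFn_sub (𝓕 f : L2 d) (𝓕 (resolvent hmm hm f) : L2 d),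
    fourier_resolvent hmm hm f] with η h₁ h₂
  have h0 := hm η
  have h3 : (1 + (m η : ℂ)) ≠ 0 := by
    have : (1 + m η) ≠ 0 := by positivity
    exact_mod_cast this
  rw [h₁, Pi.sub_apply, h₂]
  push_cast
  field_simp
  ring

/-- A Fourier multiplier with nonnegative symbol is nonnegative and self-adjoint. -/
theorem isNonnegSelfAdjoint_multiplier (hmm : Measurable m) (hm : ∀ η, 0 ≤ m η) :
    IsNonnegSelfAdjoint (multiplier m) := by
  refine isNonnegSelfAdjoint_of_surjective (fun f g => ?_) (fun f => ?_) (fun f => ?_)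
  · rw [inner_eq_integral_fourier, inner_eq_integral_fourier]
    refine integral_congr_ae ?_
    filter_upwards [fourier_multiplier f, fourier_multiplier g] with η h₁ h₂
    rw [h₁, h₂]
    simp only [RCLike.inner_apply, map_mul, Complex.conj_ofReal]
    ring
  · rw [inner_eq_integral_fourier]
    refine integral_nonneg_of_ae ?_
    filter_upwards [fourier_multiplier f] with η h₁
    rw [h₁, RCLike.inner_apply, mul_assoc, Complex.mul_conj, ← Complex.ofReal_mul]
    change (0 : ℂ) ≤ _
    exact Complex.zero_le_real.2 (mul_nonneg (hm η) (Complex.normSq_nonneg _))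
  · have h := resolvent_mem_graph hmm hm f
    obtain ⟨y, hy, hg⟩ := (LinearPMap.mem_graph_iff _).1 h
    refine ⟨y, ?_⟩
    dsimp only at hy hg
    rw [hy, hg, add_sub_cancel]

/-- The Fourier multiplier with symbol `√m` is the square root of that with symbol `m`. -/
theorem isNonnegSqrt_multiplier (hmm : Measurable m) (hm : ∀ η, 0 ≤ m η) :
    IsNonnegSqrt (multiplier fun η => √(m η)) (multiplier m) := by
  refine ⟨isNonnegSelfAdjoint_multiplier hmm.sqrt fun η => Real.sqrt_nonneg _, fun f g => ?_⟩
  have hsq : ∀ η, (√(m η) : ℂ) * (√(m η) : ℂ) = (m η : ℂ) := fun η => by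
    rw [← Complex.ofReal_mul, Real.mul_self_sqrt (hm η)]
  constructor
  · intro h
    have hg := mem_graph_multiplier_iff.1 h
    -- Since √m ≤ 1 + m, the product is bounded by the sum of the moduli of the transforms of f and
    -- g.
    have hmem : MemLp (fun η => (√(m η) : ℂ) * (𝓕 f : L2 d) η) 2 volume := by
      refine ((Lp.memLp (𝓕 f : L2 d)).norm.add (Lp.memLp (𝓕 g : L2 d)).norm).mono ?_ ?_
      · exact (Complex.measurable_ofReal.comp hmm.sqrt).aestronglyMeasurable.mul
          (Lp.aestronglyMeasurable _)
      · filter_upwards [hg] with η hη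
        rw [Pi.add_apply, hη, norm_mul, norm_mul, Complex.norm_real, Complex.norm_real,
          Real.norm_of_nonneg (Real.sqrt_nonneg _), Real.norm_of_nonneg (hm η),
          Real.norm_of_nonneg (by have := hm η; positivity)]
        have h1 : √(m η) ≤ 1 + m η := by
          rw [Real.sqrt_le_left (by linarith [hm η])]
          nlinarith [hm η]
        nlinarith [norm_nonneg ((𝓕 f : L2 d) η)]
    let y : (multiplier fun η => √(m η)).domain := ⟨f, hmem⟩
    refine ⟨multiplier (fun η => √(m η)) y, LinearPMap.mem_graph _ y, ?_⟩
    rw [mem_graph_multiplier_iff]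
    filter_upwards [hg, fourier_multiplier y] with η h₁ h₂
    rw [h₁, h₂, ← mul_assoc, hsq]
  · rintro ⟨h, hfh, hhg⟩
    rw [mem_graph_multiplier_iff] at *
    filter_upwards [hfh, hhg] with η h₁ h₂
    rw [h₂, h₁, ← mul_assoc, hsq]

end Multiplier

/-! ### Generator and quadratic form of the multiplier semigroup -/

/-- The difference quotient `(1 - e^{-ts}) / t`, an approximation of `s` from below. -/
def expQuotient (t s : ℝ) : ℝ := t⁻¹ * (1 - Real.exp (-(t * s)))

theorem measurable_expQuotient (t : ℝ) : Measurable (expQuotient t) := by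
  unfold expQuotient
  fun_prop

theorem expQuotient_nonneg {t s : ℝ} (ht : 0 < t) (hs : 0 ≤ s) : 0 ≤ expQuotient t s := by
  have h : Real.exp (-(t * s)) ≤ 1 := Real.exp_le_one_iff.2 (neg_nonpos.2 (by positivity))
  exact mul_nonneg (inv_nonneg.2 ht.le) (sub_nonneg.2 h)

theorem expQuotient_le {t s : ℝ} (ht : 0 < t) : expQuotient t s ≤ s := by
  unfold expQuotient
  rw [inv_mul_le_iff₀ ht]
  linarith [Real.add_one_le_exp (-(t * s))]

/-- From exp(-x) ≤ 1/(1+x). With the upper bound s it squeezes the quotient to s as t → 0. -/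
theorem div_le_expQuotient {t s : ℝ} (ht : 0 < t) (hs : 0 ≤ s) :
    s / (1 + t * s) ≤ expQuotient t s := by
  have h1 : 0 < 1 + t * s := by positivity
  have h2 : Real.exp (-(t * s)) ≤ (1 + t * s)⁻¹ := by
    rw [Real.exp_neg]
    exact inv_anti₀ h1 (by linarith [Real.add_one_le_exp (t * s)])
  unfold expQuotient
  rw [le_inv_mul_iff₀ ht]
  have h3 : t * (s / (1 + t * s)) = 1 - (1 + t * s)⁻¹ := by
    field_simp
    ring
  linarith

theorem tendsto_expQuotient {s : ℝ} (hs : 0 ≤ s) :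
    Tendsto (fun t => expQuotient t s) (𝓝[>] 0) (𝓝 s) := by
  have h : Tendsto (fun t : ℝ => s / (1 + t * s)) (𝓝[>] 0) (𝓝 s) := by
    have hc : ContinuousAt (fun t : ℝ => s / (1 + t * s)) 0 := by
      refine ContinuousAt.div (by fun_prop) (by fun_prop) ?_
      simp
    have := hc.tendsto.mono_left (nhdsWithin_le_nhds (s := Set.Ioi 0))
    simpa using this
  refine tendsto_of_tendsto_of_tendsto_of_le_of_le' h tendsto_const_nhds ?_ ?_
  · filter_upwards [self_mem_nhdsWithin] with t ht using div_le_expQuotient ht hs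
  · filter_upwards [self_mem_nhdsWithin] with t ht using expQuotient_le ht

theorem tendsto_coe_nnreal_nhdsGT_zero :
    Tendsto (fun t : ℝ≥0 => (t : ℝ)) (𝓝[>] 0) (𝓝[>] 0) :=
  tendsto_nhdsWithin_iff.2 ⟨(NNReal.continuous_coe.tendsto 0).mono_left nhdsWithin_le_nhds,
    by filter_upwards [self_mem_nhdsWithin] with t ht using ht⟩

section Form

variable {d : ℕ} {m : EuclideanSpace ℝ (Fin d) → ℝ} {T : ℝ≥0 → L2 d →L[ℂ] L2 d}

theorem norm_sq_eq_integral_fourier (f : L2 d) : ‖f‖ ^ 2 = ∫ η, ‖(𝓕 f : L2 d) η‖ ^ 2 := by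
  have h := inner_eq_integral_fourier f f
  rw [inner_self_eq_norm_sq_to_K] at h
  simp only [inner_self_eq_norm_sq_to_K] at h
  have h2 : ∫ η, ((‖(𝓕 f : L2 d) η‖ : ℂ)) ^ 2 = ((∫ η, ‖(𝓕 f : L2 d) η‖ ^ 2 : ℝ) : ℂ) := by
    rw [← integral_complex_ofReal]
    push_cast
    rfl
  have h3 : ((‖f‖ ^ 2 : ℝ) : ℂ) = ((∫ η, ‖(𝓕 f : L2 d) η‖ ^ 2 : ℝ) : ℂ) := by
    rw [← h2]
    push_cast
    exact h
  exact_mod_cast h3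

theorem integrable_norm_sq (f : L2 d) : Integrable (fun η => ‖f η‖ ^ 2) :=
  (memLp_two_iff_integrable_sq_norm (Lp.aestronglyMeasurable f)).1 (Lp.memLp f)

theorem mem_neg_graph_iff {H : Type*} [NormedAddCommGroup H] [InnerProductSpace ℂ H]
    {A : H →ₗ.[ℂ] H} {f g : H} : (f, g) ∈ (-A).graph ↔ (f, -g) ∈ A.graph := by
  rw [LinearPMap.mem_graph_iff, LinearPMap.mem_graph_iff]
  constructor
  · rintro ⟨y, hy, hg⟩
    exact ⟨y, hy, neg_eq_iff_eq_neg.1 hg⟩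
  · rintro ⟨y, hy, hg⟩
    exact ⟨y, hy, neg_eq_iff_eq_neg.2 hg⟩

/-- The family `T` acts on the Fourier side as multiplication by `e^{-tm}`. -/
def IsMultiplierFamily (m : EuclideanSpace ℝ (Fin d) → ℝ) (T : ℝ≥0 → L2 d →L[ℂ] L2 d) : Prop :=
  ∀ t : ℝ≥0, 0 < t → ∀ f : L2 d, (𝓕 (T t f) : L2 d) =ᵐ[volume]
    fun η => ((Real.exp (-(t * m η)) : ℝ) : ℂ) * (𝓕 f : L2 d) η

theorem IsMultiplierFamily.fourier_quotient (hT : IsMultiplierFamily m T) {t : ℝ≥0} (ht : 0 < t)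
    (f : L2 d) : (𝓕 ((((t : ℝ)⁻¹ : ℝ) : ℂ) • (T t f - f)) : L2 d) =ᵐ[volume]
      fun η => -((expQuotient t (m η) : ℝ) : ℂ) * (𝓕 f : L2 d) η := by
  have e : (𝓕 ((((t : ℝ)⁻¹ : ℝ) : ℂ) • (T t f - f)) : L2 d) =
      (((t : ℝ)⁻¹ : ℝ) : ℂ) • ((𝓕 (T t f) : L2 d) - (𝓕 f : L2 d)) := by
    rw [FourierTransform.fourier_smul]
    congr 1
    exact (Lp.fourierTransformₗᵢ (EuclideanSpace ℝ (Fin d)) ℂ).map_sub _ _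
  rw [e]
  filter_upwards [hT t ht f, Lp.coeFn_sub (𝓕 (T t f) : L2 d) (𝓕 f : L2 d),
    Lp.coeFn_smul (((t : ℝ)⁻¹ : ℝ) : ℂ) ((𝓕 (T t f) : L2 d) - (𝓕 f : L2 d))] with η h₁ h₂ h₃
  rw [h₃, Pi.smul_apply, h₂, Pi.sub_apply, h₁, smul_eq_mul, expQuotient]
  push_cast
  ring

/-- By Plancherel the squared distance to the limit is ∫ (m - (1 - e^(-tm))/t)² |𝓕 f|². The
integrand is dominated by |m 𝓕 f|² = |𝓕 g|² and tends to zero pointwise. -/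
theorem IsMultiplierFamily.tendsto_quotient (hT : IsMultiplierFamily m T) (hmm : Measurable m)
    (hm : ∀ η, 0 ≤ m η) {f g : L2 d} (h : (f, g) ∈ (multiplier m).graph) :
    Tendsto (fun t : ℝ≥0 => (((t : ℝ)⁻¹ : ℝ) : ℂ) • (T t f - f)) (𝓝[>] 0) (𝓝 (-g)) := by
  have hg := mem_graph_multiplier_iff.1 h
  rw [tendsto_iff_norm_sub_tendsto_zero]
  have key : Tendsto (fun t : ℝ≥0 => ∫ η, ((m η - expQuotient t (m η)) * ‖(𝓕 f : L2 d) η‖) ^ 2)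
      (𝓝[>] 0) (𝓝 0) := by
    have h0 : ∫ η : EuclideanSpace ℝ (Fin d), (0 : ℝ) = 0 := integral_zero _ _
    rw [← h0]
    refine tendsto_integral_filter_of_dominated_convergence (fun η => ‖(𝓕 g : L2 d) η‖ ^ 2)
      (Eventually.of_forall fun t => ?_) ?_ (integrable_norm_sq _) (ae_of_all _ fun η => ?_)
    · exact ((hmm.sub ((measurable_expQuotient t).comp hmm)).aestronglyMeasurable.mul
        (Lp.aestronglyMeasurable _).norm).pow 2
    · filter_upwards [self_mem_nhdsWithin] with t ht
      filter_upwards [hg] with η hη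
      have h1 := expQuotient_nonneg (t := t) ht (hm η)
      have h2 := expQuotient_le (t := t) (s := m η) ht
      rw [hη, norm_mul, Complex.norm_real, Real.norm_of_nonneg (hm η), norm_pow,
        Real.norm_of_nonneg (mul_nonneg (by linarith) (norm_nonneg _))]
      have h3 : m η - expQuotient t (m η) ≤ m η := by linarith
      have h4 : 0 ≤ m η - expQuotient t (m η) := by linarith
      gcongr
    · have h1 := (tendsto_expQuotient (hm η)).comp tendsto_coe_nnreal_nhdsGT_zero
      have h2 := (((tendsto_const_nhds (x := m η)).sub h1).mul_const ‖(𝓕 f : L2 d) η‖).pow 2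
      simpa using h2
  have key' := key.sqrt
  rw [Real.sqrt_zero] at key'
  refine key'.congr' ?_
  filter_upwards [self_mem_nhdsWithin] with t ht
  rw [Real.sqrt_eq_iff_mul_self_eq (integral_nonneg fun η => sq_nonneg _) (norm_nonneg _),
    ← pow_two, norm_sq_eq_integral_fourier]
  refine integral_congr_ae ?_
  rw [sub_neg_eq_add, FourierTransform.fourier_add]
  filter_upwards [hT.fourier_quotient ht f, hg,
    Lp.coeFn_add (𝓕 ((((t : ℝ)⁻¹ : ℝ) : ℂ) • (T t f - f)) : L2 d) (𝓕 g : L2 d)] with η h₁ h₂ h₃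
  rw [h₃, Pi.add_apply, h₁, h₂]
  have e : -((expQuotient t (m η) : ℝ) : ℂ) * (𝓕 f : L2 d) η + (m η : ℂ) * (𝓕 f : L2 d) η =
      ((m η - expQuotient t (m η) : ℝ) : ℂ) * (𝓕 f : L2 d) η := by
    push_cast
    ring
  rw [e, norm_mul, Complex.norm_real, mul_pow, mul_pow, Real.norm_eq_abs, sq_abs]

theorem IsMultiplierFamily.resolvent_comm (hT : IsMultiplierFamily m T) (hmm : Measurable m)
    (hm : ∀ η, 0 ≤ m η) {t : ℝ≥0} (ht : 0 < t) (f : L2 d) :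
    resolvent hmm hm (T t f) = T t (resolvent hmm hm f) := by
  refine fourier_injective ?_
  filter_upwards [fourier_resolvent hmm hm (T t f), hT t ht f, hT t ht (resolvent hmm hm f),
    fourier_resolvent hmm hm f] with η h₁ h₂ h₃ h₄
  rw [h₁, h₂, h₃, h₄, mul_left_comm]

/-- The generator of the semigroup of multipliers `e^{-tm}` is `-m`. -/
theorem IsMultiplierFamily.isGenerator (hT : IsMultiplierFamily m T) (hmm : Measurable m)
    (hm : ∀ η, 0 ≤ m η) : IsGenerator (-multiplier m) T := by
  intro f g
  rw [mem_neg_graph_iff]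
  constructor
  · intro h
    simpa only [neg_neg] using hT.tendsto_quotient hmm hm h
  · intro h
    -- Let R be the resolvent. It commutes with `T t`, and R f lies in the domain, so the quotients
    -- of R f tend both to R g and to -(f - R f). Hence f = R(f - g), which puts f in the domain
    -- with image -g under the multiplier.
    have h1 := ((resolvent hmm hm).continuous.tendsto g).comp h
    have h2 := hT.tendsto_quotient hmm hm (resolvent_mem_graph hmm hm f)
    have h3 : resolvent hmm hm g = -(f - resolvent hmm hm f) := by
      refine tendsto_nhds_unique h1 (h2.congr' ?_)
      filter_upwards [self_mem_nhdsWithin] with t ht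
      rw [Function.comp_apply, map_smul, map_sub, hT.resolvent_comm hmm hm ht]
    have h4 : resolvent hmm hm (f - g) = f := by
      rw [map_sub, h3]
      abel
    have h5 := resolvent_mem_graph hmm hm (f - g)
    rw [h4] at h5
    simpa using h5

/-- These bounded forms approximate the quadratic form of the multiplier from below and make sense
for every f in L². They can therefore be evaluated at |f| before it is known to lie in the form
domain. -/
theorem IsMultiplierFamily.integral_expQuotient (hT : IsMultiplierFamily m T)
    (hmm : Measurable m) (hm : ∀ η, 0 ≤ m η) {t : ℝ≥0} (ht : 0 < t) (f : L2 d) :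
    Integrable (fun η => expQuotient t (m η) * ‖(𝓕 f : L2 d) η‖ ^ 2) ∧
    ∫ η, expQuotient t (m η) * ‖(𝓕 f : L2 d) η‖ ^ 2 =
      (t : ℝ)⁻¹ * (‖f‖ ^ 2 - (inner ℂ f (T t f)).re) := by
  have ht' : (0 : ℝ) < t := ht
  have hi : Integrable (fun η => Real.exp (-(t * m η)) * ‖(𝓕 f : L2 d) η‖ ^ 2) := by
    refine (integrable_norm_sq (𝓕 f : L2 d)).bdd_mul (c := 1) (by fun_prop) (ae_of_all _ fun η => ?_)
    rw [Real.norm_of_nonneg (Real.exp_pos _).le]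
    exact Real.exp_le_one_iff.2 (neg_nonpos.2 (mul_nonneg ht'.le (hm η)))
  have he : ∀ η, expQuotient t (m η) * ‖(𝓕 f : L2 d) η‖ ^ 2 =
      (t : ℝ)⁻¹ * (‖(𝓕 f : L2 d) η‖ ^ 2 - Real.exp (-(t * m η)) * ‖(𝓕 f : L2 d) η‖ ^ 2) :=
    fun η => by
      rw [expQuotient]
      ring
  have hin : (inner ℂ f (T t f)).re = ∫ η, Real.exp (-(t * m η)) * ‖(𝓕 f : L2 d) η‖ ^ 2 := by
    rw [inner_eq_integral_fourier]
    have : ∫ η, inner ℂ ((𝓕 f : L2 d) η) ((𝓕 (T t f) : L2 d) η) =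
        ∫ η, ((Real.exp (-(t * m η)) * ‖(𝓕 f : L2 d) η‖ ^ 2 : ℝ) : ℂ) := by
      refine integral_congr_ae ?_
      filter_upwards [hT t ht f] with η hη
      rw [hη, RCLike.inner_apply, mul_assoc, Complex.mul_conj, Complex.normSq_eq_norm_sq]
      push_cast
      rfl
    rw [this, integral_complex_ofReal, Complex.ofReal_re]
  simp only [he]
  refine ⟨((integrable_norm_sq _).sub hi).const_mul _, ?_⟩
  rw [integral_const_mul, integral_sub (integrable_norm_sq _) hi, ← norm_sq_eq_integral_fourier,
    hin]

/-! ### The absolute value and the quadratic form -/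

theorem coeFn_absL2 (f : L2 d) : absL2 f =ᵐ[volume] fun x => ((‖f x‖ : ℝ) : ℂ) :=
  MemLp.coeFn_toLp _

theorem norm_absL2 (f : L2 d) : ‖absL2 f‖ = ‖f‖ := by
  refine le_antisymm (Lp.norm_le_norm_of_ae_le ?_) (Lp.norm_le_norm_of_ae_le ?_)
  all_goals
    filter_upwards [coeFn_absL2 f] with x hx
    rw [hx, Complex.norm_real, norm_norm]

/-- If `T t` is dominated by its action on absolute values, then passing to the absolute value
does not increase the quadratic form. -/
theorem IsMultiplierFamily.abs_form (hT : IsMultiplierFamily m T) (hmm : Measurable m)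
    (hm : ∀ η, 0 ≤ m η)
    (hdom : ∀ t : ℝ≥0, 0 < t → ∀ f : L2 d,
      (inner ℂ f (T t f)).re ≤ (inner ℂ (absL2 f) (T t (absL2 f))).re)
    (f : (multiplier fun η => √(m η)).domain) :
    ∃ h : absL2 (f : L2 d) ∈ (multiplier fun η => √(m η)).domain,
      ‖multiplier (fun η => √(m η)) ⟨absL2 (f : L2 d), h⟩‖ ≤
        ‖multiplier (fun η => √(m η)) f‖ := by
  let B := multiplier fun η => √(m η)
  let u : L2 d := absL2 (f : L2 d)
  have hBf : (𝓕 (B f) : L2 d) =ᵐ[volume] fun η => (√(m η) : ℂ) * (𝓕 (f : L2 d) : L2 d) η :=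
    fourier_multiplier f
  have hsq : ∀ v : L2 d, ∀ η, ‖(√(m η) : ℂ) * v η‖ ^ 2 = m η * ‖v η‖ ^ 2 := fun v η => by
    rw [norm_mul, Complex.norm_real, Real.norm_of_nonneg (Real.sqrt_nonneg _), mul_pow,
      Real.sq_sqrt (hm η)]
  -- Since ‖|f|‖ = ‖f‖, the domination hypothesis bounds the approximate form of |f| by that of f,
  -- which is at most ‖B f‖².
  have hform : ∀ t : ℝ≥0, 0 < t →
      ∫ η, expQuotient t (m η) * ‖(𝓕 u : L2 d) η‖ ^ 2 ≤ ‖B f‖ ^ 2 := by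
    intro t ht
    have ht' : (0 : ℝ) < t := ht
    obtain ⟨hi, he⟩ := hT.integral_expQuotient hmm hm ht (f : L2 d)
    rw [(hT.integral_expQuotient hmm hm ht u).2, norm_absL2]
    refine le_trans ?_ (le_trans he.ge ?_)
    · exact mul_le_mul_of_nonneg_left (sub_le_sub_left (hdom t ht f) _) (inv_nonneg.2 ht'.le)
    · rw [norm_sq_eq_integral_fourier]
      refine integral_mono_ae hi (integrable_norm_sq _) ?_
      filter_upwards [hBf] with η hη
      rw [hη, hsq]
      exact mul_le_mul_of_nonneg_right (expQuotient_le ht') (sq_nonneg _)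
  have hmeas : Measurable fun η => m η * ‖(𝓕 u : L2 d) η‖ ^ 2 :=
    hmm.mul ((Lp.stronglyMeasurable _).measurable.norm.pow_const 2)
  -- Fatou along t = 1/(n+1) yields both conclusions at once: finiteness places |f| in the domain,
  -- and the value is the norm inequality.
  have hfatou : ∫⁻ η, ENNReal.ofReal (m η * ‖(𝓕 u : L2 d) η‖ ^ 2) ≤
      ENNReal.ofReal (‖B f‖ ^ 2) := by
    have hlim : ∀ η, Tendsto (fun n : ℕ => ENNReal.ofReal
        (expQuotient (1 / ((n : ℝ) + 1)) (m η) * ‖(𝓕 u : L2 d) η‖ ^ 2)) atTop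
        (𝓝 (ENNReal.ofReal (m η * ‖(𝓕 u : L2 d) η‖ ^ 2))) := by
      intro η
      have h1 : Tendsto (fun n : ℕ => 1 / ((n : ℝ) + 1)) atTop (𝓝[>] 0) :=
        tendsto_nhdsWithin_iff.2 ⟨tendsto_one_div_add_atTop_nhds_zero_nat,
          Eventually.of_forall fun n => by
            rw [Set.mem_Ioi]
            positivity⟩
      exact ENNReal.tendsto_ofReal (((tendsto_expQuotient (hm η)).comp h1).mul_const _)
    calc ∫⁻ η, ENNReal.ofReal (m η * ‖(𝓕 u : L2 d) η‖ ^ 2)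
        = ∫⁻ η, liminf (fun n : ℕ => ENNReal.ofReal
          (expQuotient (1 / ((n : ℝ) + 1)) (m η) * ‖(𝓕 u : L2 d) η‖ ^ 2)) atTop :=
          lintegral_congr fun η => (hlim η).liminf_eq.symm
      _ ≤ liminf (fun n : ℕ => ∫⁻ η, ENNReal.ofReal
          (expQuotient (1 / ((n : ℝ) + 1)) (m η) * ‖(𝓕 u : L2 d) η‖ ^ 2)) atTop := by
          refine lintegral_liminf_le fun n => ?_
          exact (((measurable_expQuotient _).comp hmm).mul
            ((Lp.stronglyMeasurable _).measurable.norm.pow_const 2)).ennreal_ofReal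
      _ ≤ ENNReal.ofReal (‖B f‖ ^ 2) := by
          refine liminf_le_of_frequently_le' (Frequently.of_forall fun n => ?_)
          have hn : (0 : ℝ) < 1 / ((n : ℝ) + 1) := by positivity
          have hn' : (0 : ℝ≥0) < ⟨1 / ((n : ℝ) + 1), hn.le⟩ := hn
          refine (ofReal_integral_eq_lintegral_ofReal (hT.integral_expQuotient hmm hm hn' u).1
            (ae_of_all _ fun η => mul_nonneg (expQuotient_nonneg hn (hm η))
              (sq_nonneg _))).symm.trans_le ?_
          exact ENNReal.ofReal_le_ofReal (hform _ hn')
  have hint : Integrable fun η => m η * ‖(𝓕 u : L2 d) η‖ ^ 2 := by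
    refine ⟨hmeas.aestronglyMeasurable, ?_⟩
    rw [hasFiniteIntegral_iff_ofReal (ae_of_all _ fun η => mul_nonneg (hm η) (sq_nonneg _))]
    exact hfatou.trans_lt ENNReal.ofReal_lt_top
  have hmem : MemLp (fun η => (√(m η) : ℂ) * (𝓕 u : L2 d) η) 2 volume := by
    rw [memLp_two_iff_integrable_sq_norm]
    · simpa only [hsq] using hint
    · exact (Complex.measurable_ofReal.comp hmm.sqrt).aestronglyMeasurable.mul
        (Lp.aestronglyMeasurable _)
  let y : B.domain := ⟨u, hmem⟩
  refine ⟨y.2, ?_⟩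
  change ‖B y‖ ≤ ‖B f‖
  rw [← sq_le_sq₀ (norm_nonneg _) (norm_nonneg _), norm_sq_eq_integral_fourier (B y)]
  have h1 : ∫ η, ‖(𝓕 (B y) : L2 d) η‖ ^ 2 = ∫ η, m η * ‖(𝓕 u : L2 d) η‖ ^ 2 := by
    refine integral_congr_ae ?_
    filter_upwards [fourier_multiplier y] with η hη
    rw [hη, hsq]
  rw [h1, ← ENNReal.ofReal_le_ofReal_iff (sq_nonneg _), ofReal_integral_eq_lintegral_ofReal hint
    (ae_of_all _ fun η => mul_nonneg (hm η) (sq_nonneg _))]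
  exact hfatou

/-- Pointwise, the real part of conj(f)·(k ⋆ f) is at most |f|·(k ⋆ |f|), because k ≥ 0. This is the
only point where the form inequality uses positivity of the kernel directly. -/
theorem re_inner_convLp_le {k : EuclideanSpace ℝ (Fin d) → ℂ} (hk : IsDensity k) (f : L2 d) :
    (inner ℂ f (convLp hk ENNReal.ofNat_ne_top f)).re ≤
      (inner ℂ (absL2 f) (convLp hk ENNReal.ofNat_ne_top (absL2 f))).re := by
  have hre : ∀ g h : L2 d, (inner ℂ g h).re = ∫ x, (inner ℂ (g x) (h x)).re := fun g h => by
    rw [L2.inner_def]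
    exact (integral_re (L2.integrable_inner (𝕜 := ℂ) g h)).symm
  rw [hre, hre]
  have hi : ∀ g h : L2 d, Integrable fun x => (inner ℂ (g x) (h x)).re := fun g h =>
    (L2.integrable_inner (𝕜 := ℂ) g h).re
  refine integral_mono_ae (hi _ _) (hi _ _) ?_
  have hc : k ⋆[ContinuousLinearMap.mul ℂ ℂ, volume] (absL2 f) =
      k ⋆[ContinuousLinearMap.mul ℂ ℂ, volume] fun x => ((‖f x‖ : ℝ) : ℂ) :=
    convolution_congr _ (ae_eq_refl k) (coeFn_absL2 f)
  have h2 := coeFn_convLp hk ENNReal.ofNat_ne_top (absL2 f)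
  rw [hc] at h2
  filter_upwards [coeFn_convLp hk ENNReal.ofNat_ne_top f, h2, coeFn_absL2 f] with x h₁ h₂ h₃
  change (inner ℂ (f x) _).re ≤ (inner ℂ (absL2 f x) _).re
  rw [h₁, h₂, h₃, RCLike.inner_apply, RCLike.inner_apply]
  have h4 := (Complex.le_def.1 (norm_convolution_le hk f x)).1
  rw [Complex.ofReal_re] at h4
  rw [Complex.conj_ofReal, Complex.re_mul_ofReal]
  refine (Complex.re_le_norm _).trans ?_
  rw [norm_mul, RCLike.norm_conj]
  exact mul_le_mul_of_nonneg_right h4 (norm_nonneg _)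

end Form

section Assembly

variable {d : ℕ} {α β lam : ℝ}

theorem isMultiplierFamily_propagator
    (hk : ∀ t : ℝ, 0 < t → IsDensity (kernel d α β lam t))
    (hF : ∀ t : ℝ, 0 < t → 𝓕 (kernel d α β lam t) = kernelHat α β lam t) :
    IsMultiplierFamily (symbol α β lam) (propagator hk (p := 2) ENNReal.ofNat_ne_top) := by
  intro t ht f
  rw [propagator_of_pos hk _ ht, convLp_eq_boundedMultiplier]
  filter_upwards [fourier_boundedMultiplier (hk t ht).measurable_fourier
    (hk t ht).norm_fourier_le_one f] with η hη
  rw [hη, hF t ht, kernelHat]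

theorem satisfiesBeurlingDeny_propagator (hβ₀ : 0 < β) (hlam : 1 < lam)
    (hk : ∀ t : ℝ, 0 < t → IsDensity (kernel d α β lam t))
    (hF : ∀ t : ℝ, 0 < t → 𝓕 (kernel d α β lam t) = kernelHat α β lam t)
    (hmul : ∀ s t : ℝ, 0 < s → 0 < t →
      kernel d α β lam s ⋆[ContinuousLinearMap.mul ℂ ℂ, volume] kernel d α β lam t =
        kernel d α β lam (s + t)) :
    SatisfiesBeurlingDeny (multiplier (symbol α β lam))
      (multiplier fun η => √(symbol α β lam η))
      (propagator hk (p := 2) ENNReal.ofNat_ne_top) := by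
  have hmm : Measurable (symbol α β lam : EuclideanSpace ℝ (Fin d) → ℝ) :=
    (continuous_symbol hβ₀ hlam).measurable
  have hm : ∀ η : EuclideanSpace ℝ (Fin d), 0 ≤ symbol α β lam η := symbol_nonneg hlam
  have hT := isMultiplierFamily_propagator hk hF
  exact
    { nonneg_selfAdjoint := isNonnegSelfAdjoint_multiplier hmm hm
      sqrt := isNonnegSqrt_multiplier hmm hm
      semigroup := isC0ContractionSemigroup_propagator hk _ hβ₀ hlam hmul
      generator := hT.isGenerator hmm hm
      positivity := fun t _ f hf => propagator_nonneg hk _ t hf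
      abs_form := hT.abs_form hmm hm fun t ht f => by
        rw [propagator_of_pos hk _ ht]
        exact re_inner_convLp_le (hk t ht) f }

end Assembly

end LogDissipation

end

theorem mainTheorem8 (d : ℕ) (hd : d = 1 ∨ d = 2 ∨ d = 3) (p : ℝ≥0∞) [Fact (1 ≤ p)] (hp : p ≠ ⊤)
    (α β lam : ℝ) (hα : 0 ≤ α) (hβ₀ : 0 < β) (hβ₁ : β ≤ 1)
    (hlam : Real.exp ((3 + 2 * α) / β) ≤ lam) :
    -- the kernels `K_t` are well defined: integrable, with the prescribed Fourier transform
    (∀ t : ℝ, 0 < t → Integrable (LogDissipation.kernel d α β lam t) ∧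
      𝓕 (LogDissipation.kernel d α β lam t) = LogDissipation.kernelHat α β lam t) ∧
    -- the semigroup on `L^p`
    (∃ T : ℝ≥0 → LogDissipation.LpSpace d p →L[ℂ] LogDissipation.LpSpace d p,
      LogDissipation.IsPropagator α β lam p T ∧
      LogDissipation.IsC0ContractionSemigroup T ∧
      LogDissipation.IsSubMarkovian T) ∧
    -- the Beurling-Deny conditions on `L²`
    (∃ T : ℝ≥0 → LogDissipation.L2 d →L[ℂ] LogDissipation.L2 d,
      LogDissipation.IsPropagator α β lam 2 T ∧
      LogDissipation.SatisfiesBeurlingDeny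
        (LogDissipation.multiplier (LogDissipation.symbol α β lam))
        (LogDissipation.multiplier (fun η => √(LogDissipation.symbol α β lam η))) T) := by
  have hd₀ : d ≠ 0 := by omega
  have hd₃ : d ≤ 3 := by omega
  have hlam₁ := LogDissipation.one_lt_of_exp_le hα hβ₀ hlam
  have hk : ∀ t : ℝ, 0 < t → LogDissipation.IsDensity (LogDissipation.kernel d α β lam t) :=
    fun t ht => LogDissipation.isDensity_kernel hd₀ hd₃ hα hβ₀ hβ₁ hlam ht
  have hF : ∀ t : ℝ, 0 < t →
      𝓕 (LogDissipation.kernel d α β lam t) = LogDissipation.kernelHat α β lam t :=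
    fun t ht => LogDissipation.fourier_kernel hd₀ hd₃ hα hβ₀ hβ₁ hlam ht
  have hmul := fun (s t : ℝ) (hs : 0 < s) (ht : 0 < t) =>
    LogDissipation.kernel_convolution_kernel (d := d) hd₀ hd₃ hα hβ₀ hβ₁ hlam hs ht
  have hC := LogDissipation.isC0ContractionSemigroup_propagator hk hp hβ₀ hlam₁ hmul
  refine ⟨fun t ht => ⟨(hk t ht).integrable, hF t ht⟩,
    ⟨LogDissipation.propagator hk hp, LogDissipation.isPropagator_propagator hk hp, hC,
      { hC with
        nonneg := fun f hf t => LogDissipation.propagator_nonneg hk hp t hf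
        norm_le := fun f hf t => LogDissipation.propagator_norm_le hk hp t hf }⟩,
    -- The same construction at exponent 2, whatever `p` is.
    ⟨LogDissipation.propagator hk ENNReal.ofNat_ne_top,
      LogDissipation.isPropagator_propagator hk _,
      LogDissipation.satisfiesBeurlingDeny_propagator hβ₀ hlam₁ hk hF hmul⟩⟩
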